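/- (Zeroth-order adiabatic theorem.) There is an absolute constant $C>0$ with the following property. Let $N$ be a natural number and, for every evolution time $T>0$, let $H=H_T:[0,1]\to\mathbb{C}^{N\times N}$ be a Hermitian-matrix-valued function (a Hamiltonian, which may depend on $T$) that is three times differentiable on $[0,1]$, the third derivative being bounded. Write $\|\dot H\|,\|\ddot H\|,\|\dddot H\|$ for the suprema over $s\in[0,1]$ of the operator norms of the first three derivatives of $H$. Let $\gamma_{\min}$ be the infimum, over $s\in[0,1]$ and over all pairs of distinct eigenvalues of $H(s)$, of the distance between the two eigenvalues, and assume $\gamma_{\min}>0$. Let $|G(s)\rangle$ be a non-degenerate instantaneous eigenstate of $H(s)$, that is, for every $s\in[0,1]$ a unit eigenvector of $H(s)$ (of arbitrary phase) for a simple eigenvalue $E_G(s)$ that depends continuously on $s$, and let $\min_{\nu,s}\gamma_{\nu,G}(s)$ be the infimum, over $s\in[0,1]$ and over the eigenvalues $E_\nu(s)\neq E_G(s)$ of $H(s)$, of $|E_\nu(s)-E_G(s)|$. Define $$\Delta_1=\frac{1}{\gamma_{\min}}\left(\frac{\|\dddot H\|}{\gamma_{\min}}+\frac{\|\ddot H\|^3}{\gamma_{\min}^3}+\frac{\|\dot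 H\|^6}{\gamma_{\min}^6}\right),\qquad \Delta_0=\frac{\|\dot H\|}{\min_{\nu,s}[\gamma_{\nu,G}(s)]^2}+\frac{\Delta_1}{\gamma_{\min}T}.$$ Let $U(s,0)$, $s\in[0,1]$, be the time-evolution operator in the dimensionless time $s=t/T$, that is, the solution of $\frac{\mathrm d}{\mathrm ds}U(s,0)=-iT\,H(s)\,U(s,0)$, $U(0,0)=\mathbb{1}$ (with $\hbar=1$), and let $P_G(1)=|G(1)\rangle\langle G(1)|$. If $\Delta_0\in o(T)$ as $T\to\infty$, then, as $T\to\infty$, $$(\mathbb{1}-P_G(1))\,U(1,0)|G(0)\rangle=O(\Delta_0/T),$$ with implied constant $C$: for all sufficiently large $T$, $\ \|(\mathbb{1}-P_G(1))\,U(1,0)|G(0)\rangle\|\le C\,\Delta_0/T$. -/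

import Mathlib

open Set Filter Asymptotics

/-- The state space `ℂ^N` with its Euclidean (Hermitian) structure. -/
abbrev QState (N : ℕ) : Type := EuclideanSpace ℂ (Fin N)

/-- Complex `N × N` matrices, viewed as operators on `ℂ^N`; the norm is the operator norm. -/
abbrev QOp (N : ℕ) : Type := QState N →L[ℂ] QState N

/-- `H` is three times differentiable on `[0,1]` (one-sidedly at the end points), with a third
derivative of bounded norm, so that `‖H⃛‖` is a finite number.  (The first two derivatives are
differentiable or continuous on the compact interval, hence bounded automatically.) -/
structure ThriceDifferentiable {N : ℕ} (H : ℝ → QOp N) : Prop where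
  differentiableOn : ∀ k : ℕ, k < 3 →
    DifferentiableOn ℝ (iteratedDerivWithin k H (Icc 0 1)) (Icc 0 1)
  bddAbove : BddAbove ((fun s => ‖iteratedDerivWithin 3 H (Icc 0 1) s‖) '' Icc 0 1)

/-- The maximum over `s ∈ [0,1]` of the norm of the `k`-th derivative of `H`. -/
noncomputable def derivMax {N : ℕ} (k : ℕ) (H : ℝ → QOp N) : ℝ :=
  sSup ((fun s => ‖iteratedDerivWithin k H (Icc 0 1) s‖) '' Icc 0 1)

/-- The real number `μ` is an eigenvalue of the operator `A`. -/
def IsEnergy {N : ℕ} (A : QOp N) (μ : ℝ) : Prop :=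
  Module.End.HasEigenvalue (A : QState N →ₗ[ℂ] QState N) (μ : ℂ)

/-- `γ_min`: the minimum over `s ∈ [0,1]` of the distances between distinct eigenvalues
of `H s`. -/
noncomputable def gapMin {N : ℕ} (H : ℝ → QOp N) : ℝ :=
  sInf {d : ℝ | ∃ s ∈ Icc (0 : ℝ) 1, ∃ μ ν : ℝ,
    IsEnergy (H s) μ ∧ IsEnergy (H s) ν ∧ μ ≠ ν ∧ d = |μ - ν|}

/-- `min_{ν,s} γ_{ν,G}(s)`: the minimum over `s ∈ [0,1]` of the distances from `E s` to the other
eigenvalues of `H s`. -/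
noncomputable def gapFrom {N : ℕ} (H : ℝ → QOp N) (E : ℝ → ℝ) : ℝ :=
  sInf {d : ℝ | ∃ s ∈ Icc (0 : ℝ) 1, ∃ μ : ℝ, IsEnergy (H s) μ ∧ μ ≠ E s ∧ d = |μ - E s|}

/-- The timescale `Δ₁`. -/
noncomputable def timescale₁ {N : ℕ} (H : ℝ → QOp N) : ℝ :=
  1 / gapMin H * (derivMax 3 H / gapMin H + derivMax 2 H ^ 3 / gapMin H ^ 3
    + derivMax 1 H ^ 6 / gapMin H ^ 6)

/-- The timescale `Δ₀`, for the evolution time `T` and the energy branch `E`. -/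
noncomputable def timescale₀ {N : ℕ} (T : ℝ) (H : ℝ → QOp N) (E : ℝ → ℝ) : ℝ :=
  derivMax 1 H / gapFrom H E ^ 2 + timescale₁ H / (gapMin H * T)

/-- `G s` is a normalized, non-degenerate instantaneous eigenstate of `H s`, with energy `E s`,
for every `s ∈ [0,1]`; the energy `E` is a continuous branch.  The phase of `G s` is arbitrary. -/
structure IsNondegenerateEigenstate {N : ℕ} (H : ℝ → QOp N) (E : ℝ → ℝ) (G : ℝ → QState N) :
    Prop where
  continuousOn : ContinuousOn E (Icc 0 1)
  norm_eq_one : ∀ s ∈ Icc (0 : ℝ) 1, ‖G s‖ = 1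
  apply_eq : ∀ s ∈ Icc (0 : ℝ) 1, H s (G s) = (E s : ℂ) • G s
  nondegenerate : ∀ s ∈ Icc (0 : ℝ) 1,
    Module.finrank ℂ (Module.End.eigenspace (H s : QState N →ₗ[ℂ] QState N) (E s : ℂ)) = 1

/-- `U s` is the time-evolution operator `U(s,0)` in the dimensionless time `s = t/T`: the
solution on `[0,1]` of the Schrödinger equation `i U' = T H U` (with `ħ = 1`), `U 0 = 1`. -/
structure IsEvolution {N : ℕ} (T : ℝ) (H U : ℝ → QOp N) : Prop where
  init : U 0 = 1
  hasDeriv : ∀ s ∈ Icc (0 : ℝ) 1,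
    HasDerivWithinAt U (-(Complex.I * (T : ℂ)) • (H s * U s)) (Icc 0 1) s

/-- The projector `P_G(s) = |G(s)⟩⟨G(s)|`, for a unit vector `g = G(s)`. -/
noncomputable def stateProj {N : ℕ} (g : QState N) : QOp N :=
  InnerProductSpace.rankOne ℂ g g

/-- The error in the adiabatic approximation, `(1 - P_G(1)) U(1,0) |G(0)⟩`. -/
noncomputable def adiabaticError {N : ℕ} (U : ℝ → QOp N) (G : ℝ → QState N) : QState N :=
  (1 - stateProj (G 1)) (U 1 (G 0))

/-- Terms of the Dyson series for `U' = A U`. -/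
noncomputable def dysonTerm {N : ℕ} (A : ℝ → QOp N) : ℕ → ℝ → QOp N
  | 0 => fun _ => 1
  | n + 1 => fun s => ∫ t in (0 : ℝ)..s, A t * dysonTerm A n t

theorem dysonTerm_continuous {N : ℕ} {A : ℝ → QOp N} (hA : Continuous A) (n : ℕ) :
    Continuous (dysonTerm A n) := by
  induction n with
  | zero => exact continuous_const
  | succ n ih =>
    have h : Continuous fun t => A t * dysonTerm A n t := hA.mul ih
    exact intervalIntegral.continuous_primitive (fun a b => h.intervalIntegrable a b) 0

theorem dysonTerm_hasDerivAt {N : ℕ} {A : ℝ → QOp N} (hA : Continuous A) (n : ℕ) (s : ℝ) :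
    HasDerivAt (dysonTerm A (n + 1)) (A s * dysonTerm A n s) s := by
  have h : Continuous fun t => A t * dysonTerm A n t := hA.mul (dysonTerm_continuous hA n)
  exact intervalIntegral.integral_hasDerivAt_right (h.intervalIntegrable 0 s)
    h.stronglyMeasurable.stronglyMeasurableAtFilter h.continuousAt

theorem dysonTerm_norm_le {N : ℕ} {A : ℝ → QOp N} {K : ℝ} (hA : Continuous A)
    (hK0 : 0 ≤ K) (hK : ∀ t, ‖A t‖ ≤ K) (n : ℕ) (s : ℝ) :
    ‖dysonTerm A n s‖ ≤ (K * |s|) ^ n / (n.factorial : ℝ) := by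
  induction n generalizing s with
  | zero =>
    have h1 : ‖(1 : QOp N)‖ ≤ 1 := ContinuousLinearMap.norm_id_le
    simpa [dysonTerm] using h1
  | succ n ih =>
    have h : Continuous fun t => A t * dysonTerm A n t := hA.mul (dysonTerm_continuous hA n)
    have hb : ∀ t, ‖A t * dysonTerm A n t‖ ≤ K ^ (n + 1) / (n.factorial : ℝ) * |t - 0| ^ n := by
      intro t
      calc ‖A t * dysonTerm A n t‖ ≤ ‖A t‖ * ‖dysonTerm A n t‖ := norm_mul_le _ _
        _ ≤ K * ((K * |t|) ^ n / (n.factorial : ℝ)) :=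
          mul_le_mul (hK t) (ih t) (norm_nonneg _) hK0
        _ = _ := by rw [sub_zero, mul_pow]; ring
    have hg : Continuous fun t : ℝ => K ^ (n + 1) / (n.factorial : ℝ) * |t - 0| ^ n := by fun_prop
    calc ‖dysonTerm A (n + 1) s‖ ≤ ∫ t in Set.uIoc 0 s, ‖A t * dysonTerm A n t‖ :=
          intervalIntegral.norm_integral_le_integral_norm_uIoc
      _ ≤ ∫ t in Set.uIoc 0 s, K ^ (n + 1) / (n.factorial : ℝ) * |t - 0| ^ n :=
          MeasureTheory.setIntegral_mono (h.norm.integrableOn_uIoc) (hg.integrableOn_uIoc) hb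
      _ = _ := by
          rw [MeasureTheory.integral_const_mul, integral_pow_abs_sub_uIoc, sub_zero,
            Nat.factorial_succ, mul_pow]
          push_cast
          field_simp

/-- The time-evolution operator exists, for every Hamiltonian that is continuous on `[0,1]`. -/
theorem exists_isEvolution {N : ℕ} (T : ℝ) (H : ℝ → QOp N) (hH : ContinuousOn H (Icc 0 1)) :
    ∃ U : ℝ → QOp N, IsEvolution T H U := by
  set A : ℝ → QOp N := fun t =>
    -(Complex.I * (T : ℂ)) • H (Set.projIcc (0 : ℝ) 1 zero_le_one t) with hAdef
  have hc : Continuous fun t : ℝ => H (Set.projIcc (0 : ℝ) 1 zero_le_one t) :=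
    (continuousOn_iff_continuous_domRestrict.mp hH).comp continuous_projIcc
  have hA : Continuous A := hc.const_smul (-(Complex.I * (T : ℂ)))
  obtain ⟨M, hM⟩ := isCompact_Icc.exists_bound_of_continuousOn hH
  set K : ℝ := ‖-(Complex.I * (T : ℂ))‖ * |M| with hKdef
  have hK0 : 0 ≤ K := by positivity
  have hK : ∀ t, ‖A t‖ ≤ K := by
    intro t
    rw [hAdef, norm_smul]
    exact mul_le_mul_of_nonneg_left
      ((hM _ (Set.projIcc (0 : ℝ) 1 zero_le_one t).2).trans (le_abs_self M)) (norm_nonneg _)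
  have hsum : Summable fun n : ℕ => (K * 2) ^ n / (n.factorial : ℝ) :=
    Real.summable_pow_div_factorial _
  have hbd : ∀ n : ℕ, ∀ s ∈ Ioo (-1 : ℝ) 2,
      ‖dysonTerm A n s‖ ≤ (K * 2) ^ n / (n.factorial : ℝ) := by
    intro n s hs
    refine (dysonTerm_norm_le hA hK0 hK n s).trans ?_
    have : |s| ≤ 2 := abs_le.mpr ⟨by linarith [hs.1], hs.2.le⟩
    gcongr
  have h0 : (0 : ℝ) ∈ Ioo (-1 : ℝ) 2 := by constructor <;> norm_num
  have hs : ∀ s ∈ Ioo (-1 : ℝ) 2, Summable fun n => dysonTerm A n s := fun s hs' =>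
    Summable.of_norm_bounded hsum fun n => hbd n s hs'
  have hval : ∀ n, dysonTerm A (n + 1) 0 = 0 := fun n => intervalIntegral.integral_same
  have hder : ∀ s ∈ Ioo (-1 : ℝ) 2, HasDerivAt (fun s => ∑' n, dysonTerm A (n + 1) s)
      (∑' n, A s * dysonTerm A n s) s := by
    intro s hs'
    have hg0 : Summable fun n => dysonTerm A (n + 1) 0 := by simp only [hval]; exact summable_zero
    have hu : Summable fun n : ℕ => K * ((K * 2) ^ n / (n.factorial : ℝ)) := hsum.mul_left K
    have hg' : ∀ (n : ℕ) (y : ℝ), y ∈ Ioo (-1 : ℝ) 2 →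
        ‖A y * dysonTerm A n y‖ ≤ K * ((K * 2) ^ n / (n.factorial : ℝ)) := fun n y hy =>
      (norm_mul_le _ _).trans (mul_le_mul (hK y) (hbd n y hy) (norm_nonneg _) hK0)
    exact hasDerivAt_tsum_of_isPreconnected (g := fun n s => dysonTerm A (n + 1) s)
      (g' := fun n s => A s * dysonTerm A n s) hu isOpen_Ioo isPreconnected_Ioo
      (fun n y _ => dysonTerm_hasDerivAt hA n y) hg' h0 hg0 hs'
  refine ⟨fun s => 1 + ∑' n, dysonTerm A (n + 1) s, by simp [hval], ?_⟩
  intro s hs'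
  have hsI : s ∈ Ioo (-1 : ℝ) 2 := ⟨by linarith [hs'.1], by linarith [hs'.2]⟩
  have e1 : (1 : QOp N) + ∑' n, dysonTerm A (n + 1) s = ∑' n, dysonTerm A n s :=
    ((hs s hsI).tsum_eq_zero_add).symm
  have e2 : ∑' n, A s * dysonTerm A n s = A s * ∑' n, dysonTerm A n s :=
    (hs s hsI).tsum_mul_left _
  have e3 : A s = -(Complex.I * (T : ℂ)) • H s := by
    rw [hAdef]
    simp only [Set.projIcc_of_mem zero_le_one hs']
  have := ((hder s hsI).const_add (1 : QOp N)).hasDerivWithinAt (s := Icc 0 1)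
  rw [e2, e3, ← e1, smul_mul_assoc] at this
  exact this


/-!
The Schrödinger evolution transports `F 0` to `F 1` up to the integral of
`‖F' + i T [H, F]‖`, so it suffices to find `F` close to the spectral projection `P` that almost
solves the Heisenberg equation `F' = -i T [H, F]`. The projection itself does so up to `O(1)`, and
two corrections of orders `1 / T` and `1 / T²`, built from the reduced resolvent of `H` at the
energy and from derivatives of `P`, improve the residual to `O(1 / T²)`.

After rescaling to a unit gap, every quantity in this construction is a noncommutative polynomial
in `P`, the reduced resolvent and the derivatives of `H`. Its `i`-th derivative is therefore
controlled by a submultiplicative weight of order `i` in `a = sup ‖H'‖`, `b = sup ‖H''‖` and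
`d = sup ‖H'''‖`, which leaves the terms `a / T`, `b / T²`, `a b / T²`, `a² / T²`, … to be absorbed
into `a / T + (d + b³ + a⁶) / T²`. The linear term in `b` is the only obstinate one: Landau's
inequality `b ≤ 4 a + d` removes it.
-/

section Calculus

variable {R V : Type*} [NormedRing R] [NormedAlgebra ℝ R] [NormedAddCommGroup V] [NormedSpace ℝ V]

theorem hasDerivWithinAt_smul_of_eq_zero [Module R V] [IsBoundedSMul R V] [IsScalarTower ℝ R V]
    {B : ℝ → R} {B' : R} {X : ℝ → V} {I : Set ℝ} {t : ℝ} (hB : HasDerivWithinAt B B' I t)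
    (h0 : B t = 0) (hX : ContinuousWithinAt X I t) :
    HasDerivWithinAt (fun s => B s • X s) (B' • X t) I t := by
  rw [hasDerivWithinAt_iff_tendsto_slope] at hB ⊢
  refine (hB.smul (hX.mono_left (nhdsWithin_mono t sdiff_subset))).congr fun s => ?_
  simp only [slope_def_module, h0, zero_smul, sub_zero, smul_assoc]

theorem exists_hasDerivWithinAt_of_sub_smul {f : ℝ → ℝ} {Q : ℝ → V} {F' : V} {I : Set ℝ} {t : ℝ}
    (hI : UniqueDiffWithinAt ℝ I t) (hQ : ContinuousWithinAt Q I t) (hQt : Q t ≠ 0)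
    (hF : HasDerivWithinAt (fun s => (f s - f t) • Q s) F' I t) :
    ∃ f' : ℝ, HasDerivWithinAt f f' I t ∧ f' • Q t = F' := by
  obtain ⟨φ, -, hφ⟩ := exists_dual_vector ℝ (Q t) (norm_ne_zero_iff.2 hQt)
  have hφt : φ (Q t) ≠ 0 := by rw [hφ]; simpa using hQt
  have hφQ : ContinuousWithinAt (fun s => φ (Q s)) I t :=
    φ.continuous.continuousAt.comp_continuousWithinAt hQ
  have hquot := hasDerivWithinAt_smul_of_eq_zero (φ.hasFDerivAt.comp_hasDerivWithinAt t hF)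
    (by simp) (hφQ.inv₀ hφt)
  have hsub : HasDerivWithinAt (fun s => f s - f t) (φ F' • (φ (Q t))⁻¹) I t := by
    refine hquot.congr_of_eventuallyEq ?_ (by simp)
    filter_upwards [hφQ.eventually_ne hφt] with s hs
    simp [hs]
  have hf : HasDerivWithinAt f (φ F' • (φ (Q t))⁻¹) I t := by simpa using hsub.add_const (f t)
  exact ⟨_, hf, hI.eq_deriv I (hasDerivWithinAt_smul_of_eq_zero hsub (sub_self _) hQ) hF⟩

theorem norm_deriv_le_of_norm_second_deriv_le {f f' f'' : ℝ → V} {a d : ℝ}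
    (hf : ∀ s ∈ Icc (0 : ℝ) 1, HasDerivWithinAt f (f' s) (Icc 0 1) s)
    (hf' : ∀ s ∈ Icc (0 : ℝ) 1, HasDerivWithinAt f' (f'' s) (Icc 0 1) s)
    (ha : ∀ s ∈ Icc (0 : ℝ) 1, ‖f s‖ ≤ a) (hd : ∀ s ∈ Icc (0 : ℝ) 1, ‖f'' s‖ ≤ d) :
    ∀ s ∈ Icc (0 : ℝ) 1, ‖f' s‖ ≤ 4 * a + d := by
  intro s hs
  have hd0 : 0 ≤ d := (norm_nonneg _).trans (hd s hs)
  obtain ⟨r, hr, hrs⟩ : ∃ r ∈ Icc (0 : ℝ) 1, |r - s| = 1 / 2 := by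
    rcases le_total s (1 / 2) with h | h
    · refine ⟨s + 1 / 2, ⟨by linarith [hs.1], by linarith⟩, ?_⟩
      rw [add_sub_cancel_left, abs_of_pos (by norm_num)]
    · refine ⟨s - 1 / 2, ⟨by linarith, by linarith [hs.2]⟩, ?_⟩
      rw [sub_sub_cancel_left, abs_neg, abs_of_pos (by norm_num)]
  have hφ : ∀ t ∈ Icc (0 : ℝ) 1,
      HasDerivWithinAt (fun t => f t - t • f' s) (f' t - (1 : ℝ) • f' s) (Icc 0 1) t :=
    fun t ht => HasDerivWithinAt.fun_sub (hf t ht) ((hasDerivWithinAt_id t _).smul_const (f' s))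
  have hb : ∀ t ∈ Icc (0 : ℝ) 1, ‖f' t - (1 : ℝ) • f' s‖ ≤ d := by
    intro t ht
    rw [one_smul]
    refine (Convex.norm_image_sub_le_of_norm_hasDerivWithin_le hf' hd (convex_Icc 0 1) hs ht).trans
      (mul_le_of_le_one_right hd0 ?_)
    rw [Real.norm_eq_abs, abs_le]
    constructor <;> linarith [hs.1, hs.2, ht.1, ht.2]
  have h1 := Convex.norm_image_sub_le_of_norm_hasDerivWithin_le hφ hb (convex_Icc 0 1) hs hr
  rw [Real.norm_eq_abs, hrs] at h1
  have h2 : (r - s) • f' s = f r - f s - ((f r - r • f' s) - (f s - s • f' s)) := by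
    rw [sub_smul]; abel
  have h3 : 1 / 2 * ‖f' s‖ ≤ (a + a) + d * (1 / 2) := by
    rw [← hrs, ← Real.norm_eq_abs, ← norm_smul, h2, Real.norm_eq_abs, hrs]
    exact (norm_sub_le _ _).trans (add_le_add ((norm_sub_le _ _).trans
      (add_le_add (ha r hr) (ha s hs))) h1)
  linarith

theorem hasDerivWithinAt_of_mul_eq_one [HasSummableGeomSeries R] {M N : ℝ → R} {M' : R} {I : Set ℝ}
    {t : ℝ} (ht : t ∈ I) (hM : HasDerivWithinAt M M' I t) (hNM : ∀ s ∈ I, N s * M s = 1)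
    (hMN : ∀ s ∈ I, M s * N s = 1) :
    HasDerivWithinAt N (-(N t * M' * N t)) I t := by
  let u : Rˣ := ⟨M t, N t, hMN t ht, hNM t ht⟩
  have hinv : HasDerivWithinAt (fun s => Ring.inverse (M s)) (-(N t * M' * N t)) I t := by
    simpa [Function.comp_def, u] using
      (hasFDerivAt_ringInverse (𝕜 := ℝ) u).comp_hasDerivWithinAt_of_eq t hM rfl
  have hN : ∀ s ∈ I, N s = Ring.inverse (M s) := fun s hs =>
    (Ring.inverse_unit (⟨M s, N s, hMN s hs, hNM s hs⟩ : Rˣ)).symm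
  exact hinv.congr hN (hN t ht)

end Calculus

/-- A weight function on the orders of differentiation for which bounds `‖f⁽ⁱ⁾‖ ≤ w i` are
preserved, up to a constant, by Leibniz' rule. -/
structure IsJetWeight (w : ℕ → ℝ) : Prop where
  one_le : 1 ≤ w 0
  nonneg : ∀ i, 0 ≤ w i
  mul_le : ∀ i j, w i * w j ≤ w (i + j)

/-- `f` is `n` times differentiable on `I`, and its `i`-th derivative is bounded there by
`c * w (j + i)` for `i ≤ n`: the shift `j` is the order at which `f` itself is counted. -/
def JetBound {V : Type*} [NormedAddCommGroup V] [NormedSpace ℝ V] (w : ℕ → ℝ) (I : Set ℝ) (c : ℝ) :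
    ℕ → ℕ → (ℝ → V) → Prop
  | 0, j, f => ∀ s ∈ I, ‖f s‖ ≤ c * w j
  | n + 1, j, f => (∀ s ∈ I, ‖f s‖ ≤ c * w j) ∧
      ∃ f' : ℝ → V, (∀ s ∈ I, HasDerivWithinAt f (f' s) I s) ∧ JetBound w I c n (j + 1) f'

namespace JetBound

variable {V₁ V₂ V A : Type*} [NormedAddCommGroup V₁] [NormedSpace ℝ V₁] [NormedAddCommGroup V₂]
  [NormedSpace ℝ V₂] [NormedAddCommGroup V] [NormedSpace ℝ V] [NormedRing A] [NormedAlgebra ℝ A]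
  {w : ℕ → ℝ} {I : Set ℝ} {c d : ℝ} {n j k : ℕ} {f g : ℝ → V}

theorem bound (h : JetBound w I c n j f) : ∀ s ∈ I, ‖f s‖ ≤ c * w j := by
  cases n with
  | zero => exact h
  | succ n => exact h.1

theorem of_succ (h : JetBound w I c (n + 1) j f) : JetBound w I c n j f := by
  induction n generalizing j f with
  | zero => exact h.1
  | succ n ih =>
    obtain ⟨h0, f', hf', h'⟩ := h
    exact ⟨h0, f', hf', ih h'⟩

theorem of_le {m : ℕ} (hmn : m ≤ n) (h : JetBound w I c n j f) : JetBound w I c m j f := by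
  induction hmn using Nat.decreasingInduction with
  | self => exact h
  | of_succ m _ ih => exact ih.of_succ

theorem mono (hw : ∀ i, 0 ≤ w i) (hcd : c ≤ d) (h : JetBound w I c n j f) :
    JetBound w I d n j f := by
  have hle : ∀ i, c * w i ≤ d * w i := fun i => mul_le_mul_of_nonneg_right hcd (hw i)
  induction n generalizing j f with
  | zero => exact fun s hs => (h s hs).trans (hle j)
  | succ n ih =>
    obtain ⟨h0, f', hf', h'⟩ := h
    exact ⟨fun s hs => (h0 s hs).trans (hle j), f', hf', ih h'⟩

theorem cons (hw : ∀ i, 0 ≤ w i) {f' : ℝ → V} (hf : ∀ s ∈ I, ‖f s‖ ≤ c * w j)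
    (hf' : ∀ s ∈ I, HasDerivWithinAt f (f' s) I s) (h : JetBound w I d n (j + 1) f') :
    JetBound w I (max c d) (n + 1) j f :=
  ⟨fun s hs => (hf s hs).trans (mul_le_mul_of_nonneg_right (le_max_left c d) (hw j)),
    f', hf', h.mono hw (le_max_right c d)⟩

theorem clm_comp (L : V₁ →L[ℝ] V) (hL : ∀ x, ‖L x‖ ≤ ‖x‖) {f : ℝ → V₁}
    (hf : JetBound w I c n j f) : JetBound w I c n j (fun s => L (f s)) := by
  induction n generalizing j f with
  | zero => exact fun s hs => (hL _).trans (hf s hs)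
  | succ n ih =>
    obtain ⟨h0, f', hf', h'⟩ := hf
    exact ⟨fun s hs => (hL _).trans (h0 s hs), fun s => L (f' s),
      fun s hs => L.hasFDerivAt.comp_hasDerivWithinAt s (hf' s hs), ih h'⟩

theorem add (hf : JetBound w I c n j f) (hg : JetBound w I d n j g) :
    JetBound w I (c + d) n j (fun s => f s + g s) := by
  have hle : ∀ {x y : V} {i : ℕ}, ‖x‖ ≤ c * w i → ‖y‖ ≤ d * w i → ‖x + y‖ ≤ (c + d) * w i :=
    fun hx hy => (norm_add_le _ _).trans ((add_le_add hx hy).trans_eq (add_mul _ _ _).symm)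
  induction n generalizing j f g with
  | zero => exact fun s hs => hle (hf s hs) (hg s hs)
  | succ n ih =>
    obtain ⟨hf0, f', hf', hf1⟩ := hf
    obtain ⟨hg0, g', hg', hg1⟩ := hg
    exact ⟨fun s hs => hle (hf0 s hs) (hg0 s hs), fun s => f' s + g' s,
      fun s hs => (hf' s hs).add (hg' s hs), ih hf1 hg1⟩

theorem neg (hf : JetBound w I c n j f) : JetBound w I c n j (fun s => -f s) :=
  hf.clm_comp (-ContinuousLinearMap.id ℝ V) fun x => (norm_neg x).le

theorem sub (hf : JetBound w I c n j f) (hg : JetBound w I d n j g) :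
    JetBound w I (c + d) n j (fun s => f s - g s) := by
  simpa only [sub_eq_add_neg] using hf.add hg.neg

protected theorem star [StarAddMonoid V] [NormedStarGroup V] [StarModule ℝ V]
    (hf : JetBound w I c n j f) : JetBound w I c n j (fun s => star (f s)) :=
  hf.clm_comp ((starL' ℝ : V ≃L[ℝ] V) : V →L[ℝ] V) fun x => (norm_star x).le

theorem smul_const {e : ℝ → ℝ} (he : JetBound w I c n j e) {v : V} (hv : ‖v‖ ≤ 1) :
    JetBound w I c n j (fun s => e s • v) :=
  he.clm_comp (ContinuousLinearMap.toSpanSingleton ℝ v) fun r =>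
    (norm_smul_le r v).trans (mul_le_of_le_one_right (norm_nonneg r) hv)

theorem mul (hw : IsJetWeight w) (hc : 0 ≤ c) (hd : 0 ≤ d) {f g : ℝ → A}
    (hf : JetBound w I c n j f) (hg : JetBound w I d n k g) :
    JetBound w I (2 ^ n * (c * d)) n (j + k) (fun s => f s * g s) := by
  have hle : ∀ {x y : A} {j k : ℕ}, ‖x‖ ≤ c * w j → ‖y‖ ≤ d * w k →
      ‖x * y‖ ≤ c * d * w (j + k) := fun {x y j k} hx hy =>
    calc ‖x * y‖ ≤ (c * w j) * (d * w k) := norm_mul_le_of_le hx hy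
      _ = c * d * (w j * w k) := by ring
      _ ≤ c * d * w (j + k) := mul_le_mul_of_nonneg_left (hw.mul_le j k) (mul_nonneg hc hd)
  induction n generalizing j k f g with
  | zero =>
    rw [pow_zero, one_mul]
    exact fun s hs => hle (hf s hs) (hg s hs)
  | succ n ih =>
    have hf0 := hf.of_succ
    have hg0 := hg.of_succ
    obtain ⟨-, f', hf', hf1⟩ := hf
    obtain ⟨-, g', hg', hg1⟩ := hg
    have h1 := ih hf1 hg0
    have h2 := ih hf0 hg1
    rw [Nat.add_right_comm] at h1
    refine ⟨fun s hs => (hle (hf0.bound s hs) (hg0.bound s hs)).trans ?_,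
      fun s => f' s * g s + f s * g' s, fun s hs => (hf' s hs).mul (hg' s hs), ?_⟩
    · exact mul_le_mul_of_nonneg_right (le_mul_of_one_le_left (mul_nonneg hc hd)
        (one_le_pow₀ one_le_two)) (hw.nonneg _)
    · rw [pow_succ', mul_assoc, two_mul]
      exact h1.add h2

end JetBound

/-- The weights `1, a, a² + b, a³ + 2ab + d, …`: order `n` collects all products of derivatives of
total order `n`, where a first, second or third derivative counts as `a`, `b` or `d`. -/
def jetWeight (a b d : ℝ) : ℕ → ℝ
  | 0 => 1
  | 1 => a
  | 2 => a * a + b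
  | n + 3 => a * jetWeight a b d (n + 2) + b * jetWeight a b d (n + 1) + d * jetWeight a b d n

theorem jetWeight_nonneg {a b d : ℝ} (ha : 0 ≤ a) (hb : 0 ≤ b) (hd : 0 ≤ d) (i : ℕ) :
    0 ≤ jetWeight a b d i := by
  fun_induction jetWeight a b d i <;> positivity

theorem isJetWeight_jetWeight {a b d : ℝ} (ha : 0 ≤ a) (hb : 0 ≤ b) (hd : 0 ≤ d) :
    IsJetWeight (jetWeight a b d) := by
  have hw := jetWeight_nonneg ha hb hd
  have hone : ∀ j, a * jetWeight a b d j ≤ jetWeight a b d (j + 1)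
    | 0 => by simp [jetWeight]
    | 1 => by simpa only [jetWeight] using le_add_of_nonneg_right hb
    | j + 2 => by
      rw [jetWeight, add_assoc]
      exact le_add_of_nonneg_right (add_nonneg (mul_nonneg hb (hw _)) (mul_nonneg hd (hw _)))
  have htwo : ∀ j, (a * a + b) * jetWeight a b d j ≤ jetWeight a b d (j + 2)
    | 0 => by simp [jetWeight]
    | j + 1 => by
      rw [jetWeight]
      linarith [mul_le_mul_of_nonneg_left (hone (j + 1)) ha, mul_nonneg hd (hw j)]
  refine ⟨le_rfl, hw, fun i j => ?_⟩
  fun_induction jetWeight a b d i with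
  | case1 => rw [one_mul, zero_add]
  | case2 => rw [add_comm 1]; exact hone j
  | case3 => rw [add_comm 2]; exact htwo j
  | case4 n h2 h1 h0 =>
    have e : n + 3 + j = n + j + 3 := by lia
    rw [Nat.add_right_comm] at h1 h2
    rw [e, jetWeight]
    linarith [mul_le_mul_of_nonneg_left h2 ha, mul_le_mul_of_nonneg_left h1 hb,
      mul_le_mul_of_nonneg_left h0 hd]

/-- `s` is the reduced resolvent of the self-adjoint element `k` at its eigenvalue `0`, with
eigenprojection `p`: it vanishes on `p` and inverts `k` on the complement `1 - p`. -/
structure IsReducedResolvent {A : Type*} [Ring A] [StarRing A] (k p s : A) : Prop where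
  isSelfAdjoint : IsSelfAdjoint k
  isSelfAdjoint_resolvent : IsSelfAdjoint s
  isStarProjection : IsStarProjection p
  mul_proj : k * p = 0
  mul_resolvent : k * s = 1 - p
  resolvent_mul_proj : s * p = 0

namespace IsReducedResolvent

variable {A : Type*} [Ring A] [StarRing A] {k p s k' p' s' x : A}

theorem proj_mul_proj (h : IsReducedResolvent k p s) : p * p = p :=
  h.isStarProjection.isIdempotentElem

theorem proj_mul (h : IsReducedResolvent k p s) : p * k = 0 := by
  simpa [h.isSelfAdjoint.star_eq, h.isStarProjection.isSelfAdjoint.star_eq] using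
    congrArg star h.mul_proj

theorem proj_mul_resolvent (h : IsReducedResolvent k p s) : p * s = 0 := by
  simpa [h.isSelfAdjoint_resolvent.star_eq, h.isStarProjection.isSelfAdjoint.star_eq] using
    congrArg star h.resolvent_mul_proj

theorem resolvent_mul (h : IsReducedResolvent k p s) : s * k = 1 - p := by
  simpa [h.isSelfAdjoint_resolvent.star_eq, h.isStarProjection.isSelfAdjoint.star_eq,
    h.isSelfAdjoint.star_eq] using congrArg star h.mul_resolvent

theorem shift_mul_shift (h : IsReducedResolvent k p s) : (k + p) * (s + p) = 1 := by
  linear_combination (norm := noncomm_ring) h.mul_resolvent + h.mul_proj + h.proj_mul_resolvent +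
    h.proj_mul_proj

theorem shift_mul_shift' (h : IsReducedResolvent k p s) : (s + p) * (k + p) = 1 := by
  linear_combination (norm := noncomm_ring) h.resolvent_mul + h.resolvent_mul_proj + h.proj_mul +
    h.proj_mul_proj

theorem proj_sub_proj (h : IsReducedResolvent k p s) (h' : IsReducedResolvent k' p' s') :
    p' - p = s * (k - k') * p' - p * (k' - k) * s' := by
  linear_combination (norm := noncomm_ring) s * h'.mul_proj - h.resolvent_mul * p' +
    p * h'.mul_resolvent - h.proj_mul * s'

variable {l z' : A}

theorem commutator_sub_star (h : IsReducedResolvent k p s) (hpl : p * l = 0) (hlp : l * p = l) :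
    k * (s * l - star (s * l)) - (s * l - star (s * l)) * k = l + star l := by
  have hlk : l * k = 0 := by rw [← hlp, mul_assoc, h.proj_mul, mul_zero]
  have hkl : k * star l = 0 := by
    simpa [h.isSelfAdjoint.star_eq] using congrArg star hlk
  have hlp' : star l * p = 0 := by
    simpa [h.isStarProjection.isSelfAdjoint.star_eq] using congrArg star hpl
  rw [star_mul, h.isSelfAdjoint_resolvent.star_eq]
  linear_combination (norm := noncomm_ring) h.mul_resolvent * l - hpl - s * hlk - hkl * s +
    star l * h.resolvent_mul - hlp'

/-- Along a family whose projection moves with velocity `p'`, the block `z = s * l` has a velocity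
`z'` for which `hright` and `hleft` are the derivatives of `z = z * p` and `p * z = 0`. -/
theorem velocity_eq (h : IsReducedResolvent k p s) (hpl : p * l = 0) (hlp : l * p = l)
    (hp' : p' = -(l + star l)) (hright : z' = z' * p + s * l * p')
    (hleft : p' * (s * l) + p * z' = 0) :
    z' = star l * (s * l) + (1 - p) * z' * p - s * l * star l := by
  have hll : s * l * l = 0 := by
    rw [← hlp, mul_assoc, mul_assoc l p, ← mul_assoc p l p, hpl, zero_mul, mul_zero, mul_zero]
  have hlsl : l * (s * l) = 0 := by
    rw [← hlp, mul_assoc l p, ← mul_assoc p s, h.proj_mul_resolvent, zero_mul, mul_zero]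
  subst hp'
  linear_combination (norm := noncomm_ring) hright + hleft * p - hll + hlsl * p +
    star l * s * hlp

theorem commutator_second (h : IsReducedResolvent k p s) (hpl : p * l = 0)
    (hz' : z' = star l * (s * l) + (1 - p) * z' * p - s * l * star l) :
    k * (s * z' * p + star (s * z' * p) + s * l * star (s * l)) -
      (s * z' * p + star (s * z' * p) + s * l * star (s * l)) * k = z' - star z' := by
  have hstar : star z' = star l * (s * l) + p * star z' * (1 - p) - l * (star l * s) := by
    have := congrArg star hz'
    simpa [h.isSelfAdjoint_resolvent.star_eq, h.isStarProjection.isSelfAdjoint.star_eq,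
      mul_assoc] using this
  have hlp' : star l * p = 0 := by
    simpa [h.isStarProjection.isSelfAdjoint.star_eq] using congrArg star hpl
  simp only [star_mul, h.isSelfAdjoint_resolvent.star_eq,
    h.isStarProjection.isSelfAdjoint.star_eq]
  linear_combination (norm := noncomm_ring) hstar - hz' + h.mul_resolvent * z' * p -
    s * z' * h.proj_mul + h.mul_proj * star z' * s - p * star z' * h.resolvent_mul +
    h.mul_resolvent * l * star l * s - hpl * star l * s - s * l * star l * h.resolvent_mul +
    s * l * hlp'

end IsReducedResolvent

theorem commutator_sub_smul_one {A : Type*} [Ring A] [Algebra ℝ A] (h x : A) (r : ℝ) :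
    (h - r • (1 : A)) * x - x * (h - r • (1 : A)) = h * x - x * h := by
  simp only [sub_mul, mul_sub, smul_mul_assoc, mul_smul_comm, one_mul, mul_one]
  abel

theorem superadiabatic_residual {A : Type*} [Ring A] [Algebra ℂ A]
    {h p v w p' v' w' : A} {T : ℂ} (hT : T ≠ 0)
    (hp : h * p = p * h) (hv : h * v - v * h = -p') (hw : h * w - w * h = v') :
    (p' - (Complex.I / T) • v' + (T⁻¹ ^ 2) • w') + (Complex.I * T) •
      (h * (p - (Complex.I / T) • v + (T⁻¹ ^ 2) • w) -
        (p - (Complex.I / T) • v + (T⁻¹ ^ 2) • w) * h) = (T⁻¹ ^ 2) • w' := by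
  have hcomm : h * (p - (Complex.I / T) • v + (T⁻¹ ^ 2) • w) -
      (p - (Complex.I / T) • v + (T⁻¹ ^ 2) • w) * h =
      (Complex.I / T) • p' + (T⁻¹ ^ 2) • v' := by
    rw [← hw, ← neg_neg p', ← hv]
    simp only [mul_add, mul_sub, add_mul, sub_mul, mul_smul_comm, smul_mul_assoc, hp, smul_sub,
      smul_neg]
    abel
  have h1 : Complex.I * T * (Complex.I / T) = -1 := by
    field_simp; exact Complex.I_sq
  have h2 : Complex.I * T * T⁻¹ ^ 2 = Complex.I / T := by field_simp
  rw [hcomm, smul_add, smul_smul, smul_smul, h1, h2, neg_one_smul]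
  abel

/-- A differentiable family `H` of self-adjoint elements with velocity `X`, whose derivatives are
controlled by the weight `w`, together with a continuous branch `E` of eigenvalues, separated from
the rest of the spectrum by a unit gap; the gap is encoded by the bound on the reduced resolvent
`S`, and `P` is the spectral projection. -/
structure GappedFamily {A : Type*} [CStarAlgebra A] (w : ℕ → ℝ) (I : Set ℝ) (H X P S : ℝ → A)
    (E : ℝ → ℝ) : Prop where
  uniqueDiffOn : UniqueDiffOn ℝ I
  isJetWeight : IsJetWeight w
  hasDerivWithinAt : ∀ s ∈ I, HasDerivWithinAt H (X s) I s
  jet_velocity : JetBound w I 1 2 1 X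
  continuousOn_energy : ContinuousOn E I
  isReducedResolvent : ∀ s ∈ I, IsReducedResolvent (H s - E s • (1 : A)) (P s) (S s)
  proj_ne_zero : ∀ s ∈ I, P s ≠ 0
  norm_resolvent_le : ∀ s ∈ I, ‖S s‖ ≤ 1

namespace GappedFamily

variable {A : Type*} [CStarAlgebra A] {w : ℕ → ℝ} {I : Set ℝ} {H X P S : ℝ → A} {E : ℝ → ℝ} {t : ℝ}

theorem norm_proj_le (h : GappedFamily w I H X P S E) (ht : t ∈ I) : ‖P t‖ ≤ 1 :=
  IsStarProjection.norm_le (P t) (h.isReducedResolvent t ht).isStarProjection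

theorem continuousWithinAt_shift (h : GappedFamily w I H X P S E) (ht : t ∈ I) :
    ContinuousWithinAt (fun s => H s - E s • (1 : A)) I t :=
  (h.hasDerivWithinAt t ht).continuousWithinAt.sub
    ((h.continuousOn_energy t ht).smul continuousWithinAt_const)

theorem continuousWithinAt_proj (h : GappedFamily w I H X P S E) (ht : t ∈ I) :
    ContinuousWithinAt P I t := by
  set K : ℝ → A := fun s => H s - E s • (1 : A)
  have hK : ContinuousWithinAt (fun s => 2 * ‖K s - K t‖) I t :=
    ((h.continuousWithinAt_shift ht).sub continuousWithinAt_const).norm.const_mul 2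
  have hlim := hK.tendsto
  rw [sub_self, norm_zero, mul_zero] at hlim
  refine tendsto_iff_norm_sub_tendsto_zero.2 (squeeze_zero' (.of_forall fun _ => norm_nonneg _)
    ?_ hlim)
  filter_upwards [self_mem_nhdsWithin] with s hs
  have h1 : ‖S t * (K t - K s) * P s‖ ≤ 1 * ‖K s - K t‖ * 1 :=
    norm_mul_le_of_le (norm_mul_le_of_le (h.norm_resolvent_le t ht) (norm_sub_rev _ _).le)
      (h.norm_proj_le hs)
  have h2 : ‖P t * (K s - K t) * S s‖ ≤ 1 * ‖K s - K t‖ * 1 :=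
    norm_mul_le_of_le (norm_mul_le_of_le (h.norm_proj_le ht) le_rfl) (h.norm_resolvent_le s hs)
  rw [(h.isReducedResolvent t ht).proj_sub_proj (h.isReducedResolvent s hs)]
  linarith [norm_sub_le (S t * (K t - K s) * P s) (P t * (K s - K t) * S s)]

theorem resolvent_eq_inverse (h : GappedFamily w I H X P S E) (ht : t ∈ I) :
    S t = Ring.inverse (H t - E t • (1 : A) + P t) - P t :=
  eq_sub_of_add_eq (Ring.inverse_unit ⟨_, _, (h.isReducedResolvent t ht).shift_mul_shift,
    (h.isReducedResolvent t ht).shift_mul_shift'⟩).symm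

theorem continuousWithinAt_resolvent (h : GappedFamily w I H X P S E) (ht : t ∈ I) :
    ContinuousWithinAt S I t := by
  have hr := h.isReducedResolvent t ht
  have hinv : ContinuousAt Ring.inverse (H t - E t • (1 : A) + P t) :=
    NormedRing.inverse_continuousAt ⟨_, _, hr.shift_mul_shift, hr.shift_mul_shift'⟩
  exact ((hinv.comp_continuousWithinAt (f := fun s => H s - E s • (1 : A) + P s)
    ((h.continuousWithinAt_shift ht).add (h.continuousWithinAt_proj ht))).sub
    (h.continuousWithinAt_proj ht)).congr (fun s hs => h.resolvent_eq_inverse hs)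
    (h.resolvent_eq_inverse ht)

theorem exists_hasDerivWithinAt_energy (h : GappedFamily w I H X P S E) (ht : t ∈ I) :
    ∃ e : ℝ, HasDerivWithinAt E e I t ∧ e • P t = P t * X t * P t := by
  have hr := h.isReducedResolvent t ht
  have hH : ∀ s ∈ I, (E s - E t) • (P t * P s) = P t * (H s - H t) * P s := fun s hs => by
    have h1 := (h.isReducedResolvent s hs).mul_proj
    have h2 := hr.proj_mul
    rw [sub_mul, smul_mul_assoc, one_mul, sub_eq_zero] at h1
    rw [mul_sub, mul_smul_comm, mul_one, sub_eq_zero] at h2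
    rw [mul_sub, sub_mul, mul_assoc, h1, h2, mul_smul_comm, smul_mul_assoc, sub_smul]
  have hder : HasDerivWithinAt (fun s => (P t * (H s - H t)) • P s) ((P t * X t) • P t) I t :=
    hasDerivWithinAt_smul_of_eq_zero (((h.hasDerivWithinAt t ht).sub_const (H t)).const_mul (P t))
      (by simp) (h.continuousWithinAt_proj ht)
  obtain ⟨e, he, heq⟩ := exists_hasDerivWithinAt_of_sub_smul (f := E) (Q := fun s => P t * P s)
    (h.uniqueDiffOn t ht) (continuousWithinAt_const.mul (h.continuousWithinAt_proj ht))
    (by simpa only [hr.proj_mul_proj] using h.proj_ne_zero t ht)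
    (hder.congr (fun s hs => hH s hs) (hH t ht))
  exact ⟨e, he, by simpa only [hr.proj_mul_proj, smul_eq_mul] using heq⟩

theorem hasDerivWithinAt_energy (h : GappedFamily w I H X P S E) (ht : t ∈ I) :
    HasDerivWithinAt E (derivWithin E I t) I t :=
  let ⟨_, he, _⟩ := h.exists_hasDerivWithinAt_energy ht
  he.differentiableWithinAt.hasDerivWithinAt

theorem derivWithin_energy_smul_proj (h : GappedFamily w I H X P S E) (ht : t ∈ I) :
    derivWithin E I t • P t = P t * X t * P t := by
  obtain ⟨e, he, heq⟩ := h.exists_hasDerivWithinAt_energy ht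
  rwa [he.derivWithin (h.uniqueDiffOn t ht)]

theorem hasDerivWithinAt_shift (h : GappedFamily w I H X P S E) (ht : t ∈ I) :
    HasDerivWithinAt (fun s => H s - E s • (1 : A)) (X t - derivWithin E I t • (1 : A)) I t :=
  (h.hasDerivWithinAt t ht).sub ((h.hasDerivWithinAt_energy ht).smul_const 1)

theorem proj_mul_velocity_mul_proj (h : GappedFamily w I H X P S E) (ht : t ∈ I) :
    P t * (X t - derivWithin E I t • (1 : A)) * P t = 0 := by
  rw [mul_sub, sub_mul, ← h.derivWithin_energy_smul_proj ht, mul_smul_comm, smul_mul_assoc,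
    mul_one, (h.isReducedResolvent t ht).proj_mul_proj, sub_self]

theorem isSelfAdjoint_velocity (h : GappedFamily w I H X P S E) (ht : t ∈ I) :
    IsSelfAdjoint (X t - derivWithin E I t • (1 : A)) := by
  have hstar := (h.hasDerivWithinAt_shift ht).star
  exact (h.uniqueDiffOn t ht).eq_deriv I (hstar.congr
    (fun s hs => (h.isReducedResolvent s hs).isSelfAdjoint.star_eq.symm)
    (h.isReducedResolvent t ht).isSelfAdjoint.star_eq.symm) (h.hasDerivWithinAt_shift ht)

theorem resolvent_mul_velocity_mul_proj (h : GappedFamily w I H X P S E) (ht : t ∈ I) :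
    S t * (X t - derivWithin E I t • (1 : A)) * P t = S t * X t * P t := by
  rw [mul_sub, sub_mul, mul_smul_comm, mul_one, smul_mul_assoc,
    (h.isReducedResolvent t ht).resolvent_mul_proj, smul_zero, sub_zero]

theorem star_resolvent_mul_velocity_mul_proj (h : GappedFamily w I H X P S E) (ht : t ∈ I) :
    P t * (X t - derivWithin E I t • (1 : A)) * S t = star (S t * X t * P t) := by
  have hr := h.isReducedResolvent t ht
  rw [← h.resolvent_mul_velocity_mul_proj ht, star_mul, star_mul,
    hr.isSelfAdjoint_resolvent.star_eq, hr.isStarProjection.isSelfAdjoint.star_eq,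
    (h.isSelfAdjoint_velocity ht).star_eq, mul_assoc]

theorem hasDerivWithinAt_proj (h : GappedFamily w I H X P S E) (ht : t ∈ I) :
    HasDerivWithinAt P (-(S t * X t * P t + star (S t * X t * P t))) I t := by
  have hK := (h.hasDerivWithinAt_shift ht).sub_const (H t - E t • (1 : A))
  have hl := hasDerivWithinAt_smul_of_eq_zero (hK.const_mul (-S t)) (by simp)
    (h.continuousWithinAt_proj ht)
  have hr := hasDerivWithinAt_smul_of_eq_zero (hK.const_mul (-P t)) (by simp)
    (h.continuousWithinAt_resolvent ht)
  refine (((hl.add hr).add_const (P t)).congr (fun s hs => ?_) ?_).congr_deriv ?_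
  · rw [← sub_eq_iff_eq_add,
      (h.isReducedResolvent t ht).proj_sub_proj (h.isReducedResolvent s hs)]
    simp only [Pi.add_apply, smul_eq_mul]
    generalize H s - E s • (1 : A) = K, H t - E t • (1 : A) = K₀
    noncomm_ring
  · simp
  · rw [← h.star_resolvent_mul_velocity_mul_proj ht, ← h.resolvent_mul_velocity_mul_proj ht]
    generalize X t - derivWithin E I t • (1 : A) = D
    simp only [smul_eq_mul]
    noncomm_ring

theorem hasDerivWithinAt_resolvent (h : GappedFamily w I H X P S E) (ht : t ∈ I) :
    HasDerivWithinAt S (S t * (S t * X t * P t) + star (S t * (S t * X t * P t)) -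
      S t * (X t - derivWithin E I t • (1 : A)) * S t) I t := by
  have hr := h.isReducedResolvent t ht
  have hinv := hasDerivWithinAt_of_mul_eq_one ht
    ((h.hasDerivWithinAt_shift ht).add (h.hasDerivWithinAt_proj ht))
    (fun s hs => (h.isReducedResolvent s hs).shift_mul_shift')
    (fun s hs => (h.isReducedResolvent s hs).shift_mul_shift)
  refine ((hinv.sub (h.hasDerivWithinAt_proj ht)).congr (fun s _ => ?_) ?_).congr_deriv ?_
  · simp
  · simp
  have h1 := h.proj_mul_velocity_mul_proj ht
  have h2 := h.resolvent_mul_velocity_mul_proj ht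
  have h3 := h.star_resolvent_mul_velocity_mul_proj ht
  rw [star_mul (S t) (S t * X t * P t), hr.isSelfAdjoint_resolvent.star_eq, ← h3, ← h2]
  generalize X t - derivWithin E I t • (1 : A) = D at h1 ⊢
  have h4 := hr.proj_mul_proj
  have h5 := hr.proj_mul_resolvent
  have h6 := hr.resolvent_mul_proj
  linear_combination (norm := noncomm_ring) -h1 + S t * S t * D * h5 + S t * S t * D * h4 +
    h5 * D * P t * (S t + P t) + h6 * D * S t * (S t + P t) + h4 * D * S t * S t +
    P t * P t * D * h6


section Jets

variable {n : ℕ} {cS cP ce : ℝ}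

theorem norm_smul_proj (h : GappedFamily w I H X P S E) (ht : t ∈ I) (r : ℝ) :
    ‖r • P t‖ = |r| := by
  have hP := (h.isReducedResolvent t ht).isStarProjection
  have hsq : ‖P t‖ = ‖P t‖ * ‖P t‖ := by
    rw [← CStarRing.norm_star_mul_self, hP.isSelfAdjoint.star_eq, hP.isIdempotentElem.eq]
  rw [norm_smul, mul_left_cancel₀ (norm_ne_zero_iff.2 (h.proj_ne_zero t ht)) (hsq.symm.trans
    (mul_one _).symm), mul_one, Real.norm_eq_abs]

theorem jet_proj_zero (h : GappedFamily w I H X P S E) : JetBound w I 1 0 0 P := fun _ hs =>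
  (h.norm_proj_le hs).trans (h.isJetWeight.one_le.trans_eq (one_mul _).symm)

theorem jet_resolvent_zero (h : GappedFamily w I H X P S E) : JetBound w I 1 0 0 S := fun s hs =>
  (h.norm_resolvent_le s hs).trans (h.isJetWeight.one_le.trans_eq (one_mul _).symm)

theorem jet_energy_zero (h : GappedFamily w I H X P S E) :
    JetBound w I 1 0 1 (derivWithin E I) := fun s hs => by
  have hPXP : ‖P s * X s * P s‖ ≤ 1 * (1 * w 1) * 1 := norm_mul_le_of_le
    (norm_mul_le_of_le (h.norm_proj_le hs) (h.jet_velocity.bound s hs)) (h.norm_proj_le hs)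
  rwa [← h.derivWithin_energy_smul_proj hs, h.norm_smul_proj hs, one_mul, mul_one] at hPXP

theorem jet_block (h : GappedFamily w I H X P S E) (hn : n ≤ 2) (hS0 : 0 ≤ cS) (hP0 : 0 ≤ cP)
    (hS : JetBound w I cS n 0 S) (hP : JetBound w I cP n 0 P) :
    JetBound w I (4 ^ n * (cS * cP)) n 1 (fun s => S s * X s * P s) := by
  have hL := (hS.mul h.isJetWeight hS0 zero_le_one (h.jet_velocity.of_le hn)).mul h.isJetWeight
    (by positivity) hP0 hP
  refine hL.mono h.isJetWeight.nonneg (le_of_eq ?_)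
  rw [show (4 : ℝ) = 2 * 2 by norm_num, mul_pow]
  ring

theorem jet_proj_succ (h : GappedFamily w I H X P S E) {cL : ℝ} (hL0 : 1 / 2 ≤ cL)
    (hL : JetBound w I cL n 1 (fun s => S s * X s * P s)) :
    JetBound w I (2 * cL) (n + 1) 0 P := by
  have hP := JetBound.cons h.isJetWeight.nonneg h.jet_proj_zero
    (fun s hs => h.hasDerivWithinAt_proj hs) (hL.add hL.star).neg
  exact hP.mono h.isJetWeight.nonneg (max_le (by linarith) (by linarith))

theorem jet_resolvent_succ (h : GappedFamily w I H X P S E) {cL : ℝ} (hn : n ≤ 2) (hS0 : 1 ≤ cS)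
    (hL0 : 1 ≤ cL) (he0 : 0 ≤ ce) (hS : JetBound w I cS n 0 S)
    (hL : JetBound w I cL n 1 (fun s => S s * X s * P s))
    (he : JetBound w I ce n 1 (derivWithin E I)) :
    JetBound w I (2 * 2 ^ n * (cS * cL) + 4 ^ n * (cS * cS * (1 + ce))) (n + 1) 0 S := by
  have hw := h.isJetWeight
  have hZ := hS.mul hw (by linarith) (by linarith) hL
  have hD := (h.jet_velocity.of_le hn).sub
    (he.smul_const (v := (1 : A)) (IsStarProjection.norm_le 1 (.one A)))
  have hSDS := (hS.mul hw (by linarith) (by linarith) hD).mul hw (by positivity) (by linarith) hS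
  refine (JetBound.cons hw.nonneg h.jet_resolvent_zero
    (fun s hs => h.hasDerivWithinAt_resolvent hs) ((hZ.add hZ.star).sub hSDS)).mono hw.nonneg
    (max_le ?_ (le_of_eq ?_))
  · have : 1 ≤ 2 ^ n * (cS * cL) := one_le_mul_of_one_le_of_one_le (one_le_pow₀ one_le_two)
      (one_le_mul_of_one_le_of_one_le hS0 hL0)
    have : 0 ≤ 4 ^ n * (cS * cS * (1 + ce)) := by positivity
    linarith
  · rw [show (4 : ℝ) = 2 * 2 by norm_num, mul_pow]
    ring

theorem jet_proj_one (h : GappedFamily w I H X P S E) : JetBound w I 2 1 0 P := by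
  simpa using h.jet_proj_succ (by norm_num) (h.jet_block zero_le_two zero_le_one zero_le_one
    h.jet_resolvent_zero h.jet_proj_zero)

theorem jet_resolvent_one (h : GappedFamily w I H X P S E) : JetBound w I 4 1 0 S := by
  have hS := h.jet_resolvent_succ zero_le_two le_rfl (by norm_num) zero_le_one h.jet_resolvent_zero
    (h.jet_block zero_le_two zero_le_one zero_le_one h.jet_resolvent_zero h.jet_proj_zero)
    h.jet_energy_zero
  exact hS.mono h.isJetWeight.nonneg (by norm_num)

theorem jet_block_one (h : GappedFamily w I H X P S E) :
    JetBound w I 32 1 1 (fun s => S s * X s * P s) :=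
  (h.jet_block one_le_two (by norm_num) (by norm_num) h.jet_resolvent_one h.jet_proj_one).mono
    h.isJetWeight.nonneg (by norm_num)

theorem jet_energy_one (h : GappedFamily w I H X P S E) :
    JetBound w I 18 1 1 (derivWithin E I) := by
  have hw := h.isJetWeight
  obtain ⟨-, P', hP', hP1⟩ := h.jet_proj_one
  obtain ⟨-, F', hF', hF1⟩ := (h.jet_proj_one.mul hw (by norm_num) (by norm_num)
    (h.jet_velocity.of_le one_le_two)).mul hw (by norm_num) (by norm_num) h.jet_proj_one
  have hsmul : ∀ t ∈ I, HasDerivWithinAt (fun s => (derivWithin E I s - derivWithin E I t) • P s)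
      (F' t - derivWithin E I t • P' t) I t := fun t ht =>
    ((hF' t ht).sub ((hP' t ht).const_smul (derivWithin E I t))).congr
      (fun s hs => by simp [sub_smul, h.derivWithin_energy_smul_proj hs])
      (by simp [h.derivWithin_energy_smul_proj ht])
  choose! e' he' heq using fun t ht => exists_hasDerivWithinAt_of_sub_smul (h.uniqueDiffOn t ht)
    (h.continuousWithinAt_proj ht) (h.proj_ne_zero t ht) (hsmul t ht)
  have he1 : JetBound w I 18 0 2 e' := fun t ht => by
    have hle : ‖derivWithin E I t • P' t‖ ≤ 2 * w 2 :=
      calc ‖derivWithin E I t • P' t‖ ≤ (1 * w 1) * (2 * w 1) :=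
            (norm_smul_le _ _).trans (mul_le_mul (h.jet_energy_zero t ht) (hP1 t ht)
              (norm_nonneg _) (mul_nonneg zero_le_one (hw.nonneg 1)))
        _ = 2 * (w 1 * w 1) := by ring
        _ ≤ 2 * w 2 := mul_le_mul_of_nonneg_left (hw.mul_le 1 1) zero_le_two
    have hF := hF1 t ht
    rw [Real.norm_eq_abs, ← h.norm_smul_proj ht, heq t ht]
    refine (norm_sub_le _ _).trans ((add_le_add hF hle).trans_eq ?_)
    norm_num
    ring
  exact (JetBound.cons hw.nonneg h.jet_energy_zero he' he1).mono hw.nonneg (by norm_num)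

theorem jet_proj_two (h : GappedFamily w I H X P S E) : JetBound w I 64 2 0 P :=
  (h.jet_proj_succ (by norm_num) h.jet_block_one).mono h.isJetWeight.nonneg (by norm_num)

theorem jet_resolvent_two (h : GappedFamily w I H X P S E) : JetBound w I 1728 2 0 S :=
  (h.jet_resolvent_succ one_le_two (by norm_num) (by norm_num) (by norm_num) h.jet_resolvent_one
    h.jet_block_one h.jet_energy_one).mono h.isJetWeight.nonneg (by norm_num)

theorem jet_correction (h : GappedFamily w I H X P S E) :
    JetBound w I 12230590464 2 1 (fun s => S s * (S s * X s * P s)) :=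
  (h.jet_resolvent_two.mul h.isJetWeight (by norm_num) (by norm_num) (h.jet_block le_rfl
    (by norm_num) (by norm_num) h.jet_resolvent_two h.jet_proj_two)).mono h.isJetWeight.nonneg
    (by norm_num)

end Jets

theorem proj_mul_block (h : GappedFamily w I H X P S E) (ht : t ∈ I) :
    P t * (S t * X t * P t) = 0 := by
  rw [← mul_assoc, ← mul_assoc, (h.isReducedResolvent t ht).proj_mul_resolvent, zero_mul, zero_mul]

theorem block_mul_proj (h : GappedFamily w I H X P S E) (ht : t ∈ I) :
    S t * X t * P t * P t = S t * X t * P t := by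
  rw [mul_assoc, (h.isReducedResolvent t ht).proj_mul_proj]

theorem correction_velocity_eq (h : GappedFamily w I H X P S E) (ht : t ∈ I) {z' : A}
    (hz' : HasDerivWithinAt (fun s => S s * (S s * X s * P s)) z' I t) :
    z' = star (S t * X t * P t) * (S t * (S t * X t * P t)) + (1 - P t) * z' * P t -
      S t * (S t * X t * P t) * star (S t * X t * P t) := by
  have hP := h.hasDerivWithinAt_proj ht
  have hright : ∀ s ∈ I, S s * (S s * X s * P s) = S s * (S s * X s * P s) * P s := fun s hs => by
    rw [mul_assoc (S s) (S s * X s * P s) (P s), h.block_mul_proj hs]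
  have hleft : ∀ s ∈ I, 0 = P s * (S s * (S s * X s * P s)) := fun s hs => by
    rw [← mul_assoc, (h.isReducedResolvent s hs).proj_mul_resolvent, zero_mul]
  have hI := h.uniqueDiffOn t ht
  exact (h.isReducedResolvent t ht).velocity_eq (h.proj_mul_block ht) (h.block_mul_proj ht) rfl
    (hI.eq_deriv I hz' ((hz'.mul hP).congr hright (hright t ht)))
    (hI.eq_deriv I ((hP.mul hz').congr hleft (hleft t ht)) (hasDerivWithinAt_const t I 0))

theorem exists_secondCorrection (h : GappedFamily w I H X P S E) :
    ∃ Z' W : ℝ → A,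
      (∀ s ∈ I, HasDerivWithinAt (fun s => S s * (S s * X s * P s)) (Z' s) I s) ∧
      JetBound w I (10 ^ 12) 1 2 W ∧
      ∀ s ∈ I, H s * W s - W s * H s = Z' s - star (Z' s) := by
  have hw := h.isJetWeight
  obtain ⟨-, Z', hZ', hjet⟩ := h.jet_correction
  have hZ := h.jet_resolvent_one.mul hw (by norm_num) (by norm_num) h.jet_block_one
  have hA := (h.jet_resolvent_one.mul hw (by norm_num) (by norm_num) hjet).mul hw (by norm_num)
    (by norm_num) h.jet_proj_one
  have hW := (hA.add hA.star).add (hZ.mul hw (by norm_num) (by norm_num) hZ.star)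
  refine ⟨Z', _, hZ', hW.mono hw.nonneg (by norm_num), fun s hs => ?_⟩
  rw [← commutator_sub_smul_one (H s) _ (E s)]
  exact (h.isReducedResolvent s hs).commutator_second (h.proj_mul_block hs)
    (h.correction_velocity_eq hs (hZ' s hs))

theorem norm_correction_le (h : GappedFamily w I H X P S E) (ht : t ∈ I) :
    ‖S t * (S t * X t * P t)‖ ≤ w 1 := by
  have hjet := h.jet_resolvent_zero.mul h.isJetWeight zero_le_one (by norm_num)
    (h.jet_block zero_le_two zero_le_one zero_le_one h.jet_resolvent_zero h.jet_proj_zero)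
  simpa using hjet t ht

theorem commutator_proj (h : GappedFamily w I H X P S E) (ht : t ∈ I) :
    H t * P t - P t * H t = 0 := by
  have hr := h.isReducedResolvent t ht
  rw [← commutator_sub_smul_one (H t) _ (E t), hr.mul_proj, hr.proj_mul, sub_zero]

theorem commutator_correction (h : GappedFamily w I H X P S E) (ht : t ∈ I) :
    H t * (S t * (S t * X t * P t) - star (S t * (S t * X t * P t))) -
      (S t * (S t * X t * P t) - star (S t * (S t * X t * P t))) * H t =
      S t * X t * P t + star (S t * X t * P t) := by
  rw [← commutator_sub_smul_one (H t) _ (E t)]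
  exact (h.isReducedResolvent t ht).commutator_sub_star (h.proj_mul_block ht) (h.block_mul_proj ht)

/-- The superadiabatic projection: `F = P + F₁ / T + F₂ / T²` solves the Heisenberg equation
`F' = -i T [H, F]` up to `O(T⁻²)`. The terms are found by solving `[H, F₁] = i P'` and
`[H, F₂] = i F₁'` successively. -/
theorem exists_superadiabatic (h : GappedFamily w I H X P S E) {T : ℝ} (hT : 0 < T) :
    ∃ F F' : ℝ → A, (∀ s ∈ I, HasDerivWithinAt F (F' s) I s) ∧
      (∀ s ∈ I, ‖F s - P s‖ ≤ 2 * (w 1 / T) + 10 ^ 12 * (w 2 / T ^ 2)) ∧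
      ∀ s ∈ I, ‖F' s + (Complex.I * T) • (H s * F s - F s * H s)‖ ≤ 10 ^ 12 * (w 3 / T ^ 2) := by
  have hnorm : ‖Complex.I / (T : ℂ)‖ = T⁻¹ ∧ ‖(T : ℂ)⁻¹ ^ 2‖ = T⁻¹ ^ 2 := by
    simp [abs_of_pos hT]
  obtain ⟨Z', W, hZ', ⟨hW, W', hW', hW1⟩, hcomm⟩ := h.exists_secondCorrection
  set Z : ℝ → A := fun s => S s * (S s * X s * P s)
  refine ⟨fun s => P s - (Complex.I / T) • (Z s - star (Z s)) + ((T : ℂ)⁻¹ ^ 2) • W s, fun s => _,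
    fun s hs => ((h.hasDerivWithinAt_proj hs).sub (((hZ' s hs).sub (hZ' s hs).star).const_smul
      (Complex.I / T : ℂ))).add ((hW' s hs).const_smul ((T : ℂ)⁻¹ ^ 2)), fun s hs => ?_,
    fun s hs => ?_⟩
  · have h1 : ‖(Complex.I / T : ℂ) • (Z s - star (Z s))‖ ≤ T⁻¹ * (w 1 + w 1) := by
      have hZ := h.norm_correction_le hs
      rw [norm_smul, hnorm.1]
      gcongr
      exact (norm_sub_le _ _).trans (add_le_add hZ ((norm_star _).trans_le hZ))
    have h2 : ‖((T : ℂ)⁻¹ ^ 2) • W s‖ ≤ T⁻¹ ^ 2 * (10 ^ 12 * w 2) := by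
      rw [norm_smul, hnorm.2]
      gcongr
      exact hW s hs
    beta_reduce
    rw [sub_add, sub_sub_cancel_left, neg_sub]
    refine ((norm_sub_le _ _).trans (add_le_add h2 h1)).trans_eq ?_
    ring
  · have hres := superadiabatic_residual (p' := -(S s * X s * P s + star (S s * X s * P s)))
      (w' := W' s) (Complex.ofReal_ne_zero.2 hT.ne') (sub_eq_zero.1 (h.commutator_proj hs))
      ((h.commutator_correction hs).trans (neg_neg _).symm) (hcomm s hs)
    rw [hres, norm_smul, hnorm.2]
    refine (mul_le_mul_of_nonneg_left (hW1 s hs) (by positivity)).trans_eq ?_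
    ring

end GappedFamily

/-- `U` is the propagator on `[0, 1]` of the Schrödinger equation `i U' = T H U` in a
C⋆-algebra. -/
structure IsPropagator {A : Type*} [CStarAlgebra A] (T : ℝ) (H U : ℝ → A) : Prop where
  init : U 0 = 1
  hasDerivWithinAt : ∀ s ∈ Icc (0 : ℝ) 1,
    HasDerivWithinAt U (-(Complex.I * T) • (H s * U s)) (Icc 0 1) s

namespace IsPropagator

variable {A : Type*} [CStarAlgebra A] {T δ ρ : ℝ} {H U F F' P : ℝ → A} {s : ℝ}

theorem hasDerivWithinAt_star (hU : IsPropagator T H U)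
    (hH : ∀ s ∈ Icc (0 : ℝ) 1, IsSelfAdjoint (H s)) (hs : s ∈ Icc (0 : ℝ) 1) :
    HasDerivWithinAt (fun s => star (U s)) ((Complex.I * T) • (star (U s) * H s)) (Icc 0 1) s := by
  refine (hU.hasDerivWithinAt s hs).star.congr_deriv ?_
  rw [star_smul, star_mul, (hH s hs).star_eq]
  simp

theorem hasDerivWithinAt_conj (hU : IsPropagator T H U)
    (hH : ∀ s ∈ Icc (0 : ℝ) 1, IsSelfAdjoint (H s)) (hs : s ∈ Icc (0 : ℝ) 1)
    (hF : HasDerivWithinAt F (F' s) (Icc 0 1) s) :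
    HasDerivWithinAt (fun s => star (U s) * F s * U s)
      (star (U s) * (F' s + (Complex.I * T) • (H s * F s - F s * H s)) * U s) (Icc 0 1) s := by
  have hd := hU.hasDerivWithinAt s hs
  refine (((hU.hasDerivWithinAt_star hH hs).mul hF).mul hd).congr_deriv ?_
  simp only [Pi.mul_apply, mul_add, add_mul, mul_sub, sub_mul, smul_mul_assoc, mul_smul_comm,
    mul_assoc, neg_smul, smul_sub, mul_neg]
  abel

theorem star_mul_self (hU : IsPropagator T H U) (hH : ∀ s ∈ Icc (0 : ℝ) 1, IsSelfAdjoint (H s))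
    (hs : s ∈ Icc (0 : ℝ) 1) : star (U s) * U s = 1 := by
  have hconst := (convex_Icc (0 : ℝ) 1).norm_image_sub_le_of_norm_hasDerivWithin_le (C := 0)
    (fun t ht => hU.hasDerivWithinAt_conj hH ht (F' := 0) (hasDerivWithinAt_const t _ 1))
    (fun t _ => by simp) unitInterval.zero_mem hs
  rw [zero_mul, norm_le_zero_iff, sub_eq_zero] at hconst
  simpa [hU.init] using hconst

theorem norm_le_one (hU : IsPropagator T H U) (hH : ∀ s ∈ Icc (0 : ℝ) 1, IsSelfAdjoint (H s))
    (hs : s ∈ Icc (0 : ℝ) 1) : ‖U s‖ ≤ 1 := by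
  rw [← sq_le_one_iff₀ (norm_nonneg _), sq, ← CStarRing.norm_star_mul_self,
    hU.star_mul_self hH hs]
  exact IsStarProjection.norm_le 1 (.one A)

theorem mul_star_self (hU : IsPropagator T H U) (hH : ∀ s ∈ Icc (0 : ℝ) 1, IsSelfAdjoint (H s))
    (hcont : ContinuousOn H (Icc 0 1)) (hs : s ∈ Icc (0 : ℝ) 1) : U s * star (U s) = 1 := by
  obtain ⟨M, hM⟩ := isCompact_Icc.exists_bound_of_continuousOn hcont
  let Q : ℝ → A := fun s => U s * star (U s) - 1
  have hQ : ∀ s ∈ Icc (0 : ℝ) 1,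
      HasDerivWithinAt Q (-(Complex.I * T) • (H s * Q s - Q s * H s)) (Icc 0 1) s := fun s hs => by
    refine (((hU.hasDerivWithinAt s hs).mul (hU.hasDerivWithinAt_star hH hs)).sub_const
      1).congr_deriv ?_
    simp only [Q, mul_sub, sub_mul, mul_one, one_mul, smul_mul_assoc, mul_smul_comm, mul_assoc,
      neg_smul, neg_mul, smul_sub]
    abel
  have hbound : ∀ s ∈ Icc (0 : ℝ) 1,
      ‖-(Complex.I * (T : ℂ)) • (H s * Q s - Q s * H s)‖ ≤ |T| * (2 * M) * ‖Q s‖ := fun s hs => by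
    have hcomm : ‖H s * Q s - Q s * H s‖ ≤ M * ‖Q s‖ + ‖Q s‖ * M := (norm_sub_le _ _).trans
      (add_le_add (norm_mul_le_of_le (hM s hs) le_rfl) (norm_mul_le_of_le le_rfl (hM s hs)))
    rw [norm_smul, norm_neg, norm_mul, Complex.norm_I, one_mul, Complex.norm_real,
      Real.norm_eq_abs, mul_assoc]
    exact mul_le_mul_of_nonneg_left (by linarith) (abs_nonneg T)
  refine sub_eq_zero.1 (eq_zero_of_abs_deriv_le_mul_abs_self_of_eq_zero_right (f := Q)
    (fun t ht => (hQ t ht).continuousWithinAt) (fun t ht => ?_) ?_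
    (fun t ht => hbound t (Ico_subset_Icc_self ht)) s hs)
  · exact (hQ t (Ico_subset_Icc_self ht)).mono_of_mem_nhdsWithin (Icc_mem_nhdsGE_of_mem ht)
  · simp [Q, hU.init]

theorem norm_intertwining_le (hU : IsPropagator T H U)
    (hH : ∀ s ∈ Icc (0 : ℝ) 1, IsSelfAdjoint (H s)) (hcont : ContinuousOn H (Icc 0 1))
    (hF : ∀ s ∈ Icc (0 : ℝ) 1, HasDerivWithinAt F (F' s) (Icc 0 1) s)
    (hδ : ∀ s ∈ Icc (0 : ℝ) 1, ‖F' s + (Complex.I * T) • (H s * F s - F s * H s)‖ ≤ δ) :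
    ‖F 1 * U 1 - U 1 * F 0‖ ≤ δ := by
  have hU1 := hU.norm_le_one hH unitInterval.one_mem
  have hbound : ∀ s ∈ Icc (0 : ℝ) 1,
      ‖star (U s) * (F' s + (Complex.I * T) • (H s * F s - F s * H s)) * U s‖ ≤ δ := fun s hs => by
    have hUs := hU.norm_le_one hH hs
    simpa using norm_mul_le_of_le (norm_mul_le_of_le ((norm_star _).trans_le hUs) (hδ s hs)) hUs
  have hconj : ‖star (U 1) * F 1 * U 1 - F 0‖ ≤ δ := by
    simpa [hU.init] using (convex_Icc (0 : ℝ) 1).norm_image_sub_le_of_norm_hasDerivWithin_le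
      (fun s hs => hU.hasDerivWithinAt_conj hH hs (hF s hs)) hbound unitInterval.zero_mem
      unitInterval.one_mem
  calc ‖F 1 * U 1 - U 1 * F 0‖ = ‖U 1 * (star (U 1) * F 1 * U 1 - F 0)‖ := by
        rw [mul_sub, ← mul_assoc, ← mul_assoc, hU.mul_star_self hH hcont unitInterval.one_mem,
          one_mul]
    _ ≤ 1 * δ := norm_mul_le_of_le hU1 hconj
    _ = δ := one_mul δ

theorem norm_leakage_le (hU : IsPropagator T H U)
    (hH : ∀ s ∈ Icc (0 : ℝ) 1, IsSelfAdjoint (H s)) (hcont : ContinuousOn H (Icc 0 1))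
    (hF : ∀ s ∈ Icc (0 : ℝ) 1, HasDerivWithinAt F (F' s) (Icc 0 1) s)
    (hδ : ∀ s ∈ Icc (0 : ℝ) 1, ‖F' s + (Complex.I * T) • (H s * F s - F s * H s)‖ ≤ δ)
    (hP : IsStarProjection (P 1)) (hρ : ∀ s ∈ Icc (0 : ℝ) 1, ‖F s - P s‖ ≤ ρ) :
    ‖(1 - P 1) * (U 1 * P 0)‖ ≤ 2 * ρ + δ := by
  have hU1 := hU.norm_le_one hH unitInterval.one_mem
  have hY := hU.norm_intertwining_le hH hcont hF hδ
  have h1 : ‖(F 1 - P 1) * U 1‖ ≤ ρ * 1 := norm_mul_le_of_le (hρ 1 unitInterval.one_mem) hU1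
  have h0 : ‖U 1 * (F 0 - P 0)‖ ≤ 1 * ρ := norm_mul_le_of_le hU1 (hρ 0 unitInterval.zero_mem)
  have hsplit : (1 - P 1) * (U 1 * P 0) =
      (1 - P 1) * ((F 1 - P 1) * U 1 - (F 1 * U 1 - U 1 * F 0) - U 1 * (F 0 - P 0)) := by
    linear_combination (norm := noncomm_ring) -hP.isIdempotentElem.eq * U 1
  have hproj : ‖1 - P 1‖ ≤ 1 := IsStarProjection.norm_le _ hP.one_sub
  rw [hsplit]
  refine (norm_mul_le_of_le hproj ((norm_sub_le _ _).trans
    (add_le_add ((norm_sub_le _ _).trans (add_le_add h1 hY)) h0))).trans_eq ?_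
  ring

end IsPropagator

namespace GappedFamily

variable {A : Type*} [CStarAlgebra A] {H X P S U : ℝ → A} {E : ℝ → ℝ} {T : ℝ}

section Weight

variable {w : ℕ → ℝ} {I : Set ℝ} {t : ℝ}

theorem isSelfAdjoint (h : GappedFamily w I H X P S E) (ht : t ∈ I) : IsSelfAdjoint (H t) := by
  simpa using (h.isReducedResolvent t ht).isSelfAdjoint.add
    ((IsSelfAdjoint.all (E t)).smul (IsSelfAdjoint.one A))

theorem continuousOn (h : GappedFamily w I H X P S E) : ContinuousOn H I := fun t ht =>
  (h.hasDerivWithinAt t ht).continuousWithinAt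

theorem norm_leakage_le_one (h : GappedFamily w (Icc 0 1) H X P S E) (hU : IsPropagator T H U) :
    ‖(1 - P 1) * (U 1 * P 0)‖ ≤ 1 := by
  have hP1 := (h.isReducedResolvent 1 unitInterval.one_mem).isStarProjection
  have hU1 := hU.norm_le_one (fun s hs => h.isSelfAdjoint hs) unitInterval.one_mem
  simpa using norm_mul_le_of_le (IsStarProjection.norm_le _ hP1.one_sub)
    (norm_mul_le_of_le hU1 (h.norm_proj_le unitInterval.zero_mem))

theorem norm_leakage_le_velocity (h : GappedFamily w (Icc 0 1) H X P S E)
    (hU : IsPropagator T H U) : ‖(1 - P 1) * (U 1 * P 0)‖ ≤ 2 * w 1 := by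
  have hP' : ∀ s ∈ Icc (0 : ℝ) 1, ‖-(S s * X s * P s + star (S s * X s * P s)) +
      (Complex.I * T) • (H s * P s - P s * H s)‖ ≤ 2 * w 1 := fun s hs => by
    have hL := h.jet_block zero_le_two zero_le_one zero_le_one h.jet_resolvent_zero
      h.jet_proj_zero s hs
    have hstar := (norm_star (S s * X s * P s)).le
    rw [h.commutator_proj hs, smul_zero, add_zero, norm_neg]
    linarith [norm_add_le (S s * X s * P s) (star (S s * X s * P s))]
  simpa using hU.norm_leakage_le (fun s hs => h.isSelfAdjoint hs) h.continuousOn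
    (fun s hs => h.hasDerivWithinAt_proj hs) hP'
    (h.isReducedResolvent 1 unitInterval.one_mem).isStarProjection (P := P) (ρ := 0) (by simp)

theorem norm_leakage_le_superadiabatic (h : GappedFamily w (Icc 0 1) H X P S E)
    (hU : IsPropagator T H U) (hT : 0 < T) :
    ‖(1 - P 1) * (U 1 * P 0)‖ ≤
      4 * (w 1 / T) + 10 ^ 12 * (2 * (w 2 / T ^ 2) + w 3 / T ^ 2) := by
  obtain ⟨F, F', hF, hFP, hres⟩ := h.exists_superadiabatic hT
  refine (hU.norm_leakage_le (fun s hs => h.isSelfAdjoint hs) h.continuousOn hF hres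
    (h.isReducedResolvent 1 unitInterval.one_mem).isStarProjection hFP).trans_eq ?_
  ring

end Weight

end GappedFamily

section JetWeight

variable {a b d T : ℝ}

theorem jetBound_jetWeight {V : Type*} [NormedAddCommGroup V] [NormedSpace ℝ V] {I : Set ℝ}
    {X X' X'' : ℝ → V} (ha : 0 ≤ a) (hb : 0 ≤ b)
    (hX : ∀ s ∈ I, HasDerivWithinAt X (X' s) I s) (hX' : ∀ s ∈ I, HasDerivWithinAt X' (X'' s) I s)
    (hXa : ∀ s ∈ I, ‖X s‖ ≤ a) (hXb : ∀ s ∈ I, ‖X' s‖ ≤ b) (hXd : ∀ s ∈ I, ‖X'' s‖ ≤ d) :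
    JetBound (jetWeight a b d) I 1 2 1 X := by
  have hw2 : b ≤ 1 * jetWeight a b d 2 := by simp only [jetWeight]; nlinarith
  have hw3 : d ≤ 1 * jetWeight a b d 3 := by
    simp only [jetWeight]
    nlinarith [mul_nonneg ha (add_nonneg (mul_nonneg ha ha) hb), mul_nonneg hb ha]
  exact ⟨fun s hs => (hXa s hs).trans_eq (one_mul a).symm, X', hX,
    fun s hs => (hXb s hs).trans hw2, X'', hX', fun s hs => (hXd s hs).trans hw3⟩

theorem jetWeight_two_add_jetWeight_three_le (ha : 0 ≤ a) (hb : 0 ≤ b) (hd : 0 ≤ d)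
    (hbd : b ≤ 4 * a + d) (hT : 1 ≤ T) (haT : a ≤ T) :
    2 * (jetWeight a b d 2 / T ^ 2) + jetWeight a b d 3 / T ^ 2 ≤
      19 * (a / T + (d + b ^ 3 + a ^ 6) / T ^ 2) := by
  have hcube : a ^ 3 ≤ a + a ^ 6 := by
    rcases le_total a 1 with h | h
    · linarith [pow_le_of_le_one ha h three_ne_zero, pow_nonneg ha 6]
    · linarith [pow_le_pow_right₀ h (by norm_num : 3 ≤ 6)]
  have hprod : a * b ≤ b + b ^ 3 + a ^ 6 := by
    have hb3 := pow_nonneg hb 3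
    have ha6 := pow_nonneg ha 6
    rcases le_total a 1 with h | h
    · nlinarith
    · have ha2 : a ^ 2 ≤ a ^ 6 := pow_le_pow_right₀ h (by norm_num)
      nlinarith [sq_nonneg (a - b), mul_nonneg hb (sq_nonneg (b - 1))]
  have haTT : a ≤ a * T := le_mul_of_one_le_right ha hT
  have ha2 : a ^ 2 ≤ a * T := by nlinarith
  have he : 19 * (a / T + (d + b ^ 3 + a ^ 6) / T ^ 2) =
      (19 * (a * T + (d + b ^ 3 + a ^ 6))) / T ^ 2 := by field_simp
  rw [he, ← mul_div_assoc, ← add_div]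
  refine div_le_div_of_nonneg_right ?_ (sq_nonneg T)
  simp only [jetWeight]
  nlinarith [pow_nonneg ha 6, pow_nonneg hb 3]

theorem GappedFamily.norm_leakage_le {A : Type*} [CStarAlgebra A] {H X P S U : ℝ → A} {E : ℝ → ℝ}
    (h : GappedFamily (jetWeight a b d) (Icc 0 1) H X P S E) (hU : IsPropagator T H U)
    (hT : 0 < T) (hb : 0 ≤ b) (hd : 0 ≤ d) (hbd : b ≤ 4 * a + d) :
    ‖(1 - P 1) * (U 1 * P 0)‖ ≤ 10 ^ 14 * (a / T + (d + b ^ 3 + a ^ 6) / T ^ 2) := by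
  have ha : 0 ≤ a := h.isJetWeight.nonneg 1
  have haT0 : 0 ≤ a / T := by positivity
  have hrest : 0 ≤ (d + b ^ 3 + a ^ 6) / T ^ 2 := by positivity
  rcases lt_or_ge T 1 with hT1 | hT1
  · have hvel : ‖(1 - P 1) * (U 1 * P 0)‖ ≤ 2 * a := h.norm_leakage_le_velocity hU
    have : a ≤ a / T := (le_div_iff₀ hT).2 (mul_le_of_le_one_right ha hT1.le)
    linarith
  rcases lt_or_ge T a with haT | haT
  · linarith [h.norm_leakage_le_one hU, (one_le_div hT).2 haT.le]
  · have hsup : ‖(1 - P 1) * (U 1 * P 0)‖ ≤ 4 * (a / T) + 10 ^ 12 *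
      (2 * (jetWeight a b d 2 / T ^ 2) + jetWeight a b d 3 / T ^ 2) :=
      h.norm_leakage_le_superadiabatic hU hT
    linarith [jetWeight_two_add_jetWeight_three_le ha hb hd hbd hT1 haT]

end JetWeight

theorem continuousOn_of_gap {f : ℝ → ℝ} {σ : Set ℝ} {μ γ : ℝ} (hγ : 0 < γ)
    (hgap : ∀ x ∈ σ, x ≠ μ → γ ≤ |x - μ|) (hf : ContinuousOn f {μ}ᶜ) : ContinuousOn f σ := by
  intro x _
  rcases eq_or_ne x μ with rfl | hne
  · have hiso : σ ∩ Metric.ball x γ ⊆ {x} := fun y ⟨hy, hyγ⟩ => by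
      by_contra hyx
      exact (hgap y hy hyx).not_gt (by simpa [Real.dist_eq] using hyγ)
    exact (continuousWithinAt_singleton.mono hiso).mono_of_mem_nhdsWithin
      (inter_mem_nhdsWithin σ (Metric.ball_mem_nhds x hγ))
  · exact (hf.continuousAt (isOpen_compl_singleton.mem_nhds hne)).continuousWithinAt

section FunctionalCalculus

variable {A : Type*} [CStarAlgebra A] {a : A} {μ γ : ℝ}

/-- The reduced resolvent of `a` at `μ`; as `0⁻¹ = 0`, it vanishes on the eigenspace of `μ`. -/
noncomputable def reducedResolvent (a : A) (μ : ℝ) : A :=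
  cfc (fun x : ℝ => (x - μ)⁻¹) a

open Classical in
/-- The spectral projection of `a` onto the eigenspace of `μ`; it is meaningful when `μ` is isolated
in the spectrum of `a`, and `cfc` is `0` otherwise. -/
noncomputable def eigenprojection (a : A) (μ : ℝ) : A :=
  cfc (fun x : ℝ => if x = μ then 1 else 0) a

theorem continuousOn_resolvent_of_gap {σ : Set ℝ} (hγ : 0 < γ)
    (hgap : ∀ x ∈ σ, x ≠ μ → γ ≤ |x - μ|) : ContinuousOn (fun x : ℝ => (x - μ)⁻¹) σ :=
  continuousOn_of_gap hγ hgap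
    ((continuousOn_id.sub continuousOn_const).inv₀ fun _ hx => sub_ne_zero.2 hx)

open Classical in
theorem continuousOn_indicator_of_gap {σ : Set ℝ} (hγ : 0 < γ)
    (hgap : ∀ x ∈ σ, x ≠ μ → γ ≤ |x - μ|) :
    ContinuousOn (fun x : ℝ => if x = μ then (1 : ℝ) else 0) σ :=
  continuousOn_of_gap hγ hgap ((continuousOn_const (c := (0 : ℝ))).congr fun _ hx => if_neg hx)

theorem isReducedResolvent_eigenprojection (ha : IsSelfAdjoint a) (hγ : 0 < γ)
    (hgap : ∀ x ∈ spectrum ℝ a, x ≠ μ → γ ≤ |x - μ|) :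
    IsReducedResolvent (a - μ • (1 : A)) (eigenprojection a μ) (reducedResolvent a μ) := by
  have hres := continuousOn_resolvent_of_gap hγ hgap
  have hproj := continuousOn_indicator_of_gap hγ hgap
  have hshift : a - μ • (1 : A) = cfc (fun x : ℝ => x - μ) a := by
    rw [cfc_sub (fun x => x) (fun _ => μ) a, cfc_id' ℝ a, cfc_const μ a,
      Algebra.algebraMap_eq_smul_one]
  have hid : ContinuousOn (fun x : ℝ => x - μ) (spectrum ℝ a) := by fun_prop
  refine ⟨ha.sub ((IsSelfAdjoint.all μ).smul (.one A)), IsSelfAdjoint.cfc,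
    ⟨?_, IsSelfAdjoint.cfc⟩, ?_, ?_, ?_⟩
  · rw [IsIdempotentElem, eigenprojection, ← cfc_mul _ _ a]
    exact cfc_congr fun x _ => by simp
  · rw [hshift, eigenprojection, ← cfc_mul _ _ a, ← cfc_zero ℝ a]
    exact cfc_congr fun x _ => by by_cases h : x = μ <;> simp [h]
  · rw [hshift, reducedResolvent, eigenprojection, ← cfc_mul _ _ a, ← cfc_one ℝ a, ← cfc_sub _ _ a]
    exact cfc_congr fun x _ => by by_cases h : x = μ <;> simp [h, sub_ne_zero]
  · rw [reducedResolvent, eigenprojection, ← cfc_mul _ _ a, ← cfc_zero ℝ a]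
    exact cfc_congr fun x _ => by by_cases h : x = μ <;> simp [h]

theorem norm_reducedResolvent_le (hγ : 0 < γ)
    (hgap : ∀ x ∈ spectrum ℝ a, x ≠ μ → γ ≤ |x - μ|) : ‖reducedResolvent a μ‖ ≤ γ⁻¹ := by
  refine norm_cfc_le (inv_nonneg.2 hγ.le) fun x hx => ?_
  rcases eq_or_ne x μ with rfl | hne
  · simpa using hγ.le
  · rw [norm_inv, Real.norm_eq_abs]
    exact inv_anti₀ hγ (hgap x hx hne)

theorem eigenprojection_ne_zero (ha : IsSelfAdjoint a) (hμ : μ ∈ spectrum ℝ a) (hγ : 0 < γ)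
    (hgap : ∀ x ∈ spectrum ℝ a, x ≠ μ → γ ≤ |x - μ|) : eigenprojection a μ ≠ 0 := fun h0 => by
  have hproj := continuousOn_indicator_of_gap hγ hgap
  rw [eigenprojection, ← cfc_zero ℝ a, cfc_eq_cfc_iff_eqOn] at h0
  simpa using h0 hμ

end FunctionalCalculus

theorem IsReducedResolvent.smul {A : Type*} [Ring A] [StarRing A] [Algebra ℝ A] [StarModule ℝ A]
    {k p s : A} (h : IsReducedResolvent k p s) {r : ℝ} (hr : r ≠ 0) :
    IsReducedResolvent (r⁻¹ • k) p (r • s) where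
  isSelfAdjoint := (IsSelfAdjoint.all r⁻¹).smul h.isSelfAdjoint
  isSelfAdjoint_resolvent := (IsSelfAdjoint.all r).smul h.isSelfAdjoint_resolvent
  isStarProjection := h.isStarProjection
  mul_proj := by rw [smul_mul_assoc, h.mul_proj, smul_zero]
  mul_resolvent := by rw [smul_mul_smul_comm, inv_mul_cancel₀ hr, one_smul, h.mul_resolvent]
  resolvent_mul_proj := by rw [smul_mul_assoc, h.resolvent_mul_proj, smul_zero]

theorem IsPropagator.rescale {A : Type*} [CStarAlgebra A] {T γ : ℝ} {H U : ℝ → A}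
    (hU : IsPropagator T H U) (hγ : γ ≠ 0) : IsPropagator (γ * T) (fun s => γ⁻¹ • H s) U where
  init := hU.init
  hasDerivWithinAt s hs := by
    have hγ' : (γ : ℂ) ≠ 0 := Complex.ofReal_ne_zero.2 hγ
    refine (hU.hasDerivWithinAt s hs).congr_deriv ?_
    rw [smul_mul_assoc, ← Complex.coe_smul γ⁻¹, smul_smul]
    congr 1
    push_cast
    field_simp

section General

variable {A : Type*} [CStarAlgebra A] {H H₁ H₂ H₃ U : ℝ → A} {E : ℝ → ℝ} {T γ a b d : ℝ}

theorem gappedFamily_rescale (hγ : 0 < γ) (hb : 0 ≤ b)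
    (hsa : ∀ s ∈ Icc (0 : ℝ) 1, IsSelfAdjoint (H s))
    (hH : ∀ s ∈ Icc (0 : ℝ) 1, HasDerivWithinAt H (H₁ s) (Icc 0 1) s)
    (hH₁ : ∀ s ∈ Icc (0 : ℝ) 1, HasDerivWithinAt H₁ (H₂ s) (Icc 0 1) s)
    (hH₂ : ∀ s ∈ Icc (0 : ℝ) 1, HasDerivWithinAt H₂ (H₃ s) (Icc 0 1) s)
    (ha₁ : ∀ s ∈ Icc (0 : ℝ) 1, ‖γ⁻¹ • H₁ s‖ ≤ a) (hb₂ : ∀ s ∈ Icc (0 : ℝ) 1, ‖γ⁻¹ • H₂ s‖ ≤ b)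
    (hd₃ : ∀ s ∈ Icc (0 : ℝ) 1, ‖γ⁻¹ • H₃ s‖ ≤ d) (hE : ContinuousOn E (Icc 0 1))
    (hmem : ∀ s ∈ Icc (0 : ℝ) 1, E s ∈ spectrum ℝ (H s))
    (hgap : ∀ s ∈ Icc (0 : ℝ) 1, ∀ x ∈ spectrum ℝ (H s), x ≠ E s → γ ≤ |x - E s|) :
    GappedFamily (jetWeight a b d) (Icc 0 1) (fun s => γ⁻¹ • H s) (fun s => γ⁻¹ • H₁ s)
      (fun s => eigenprojection (H s) (E s)) (fun s => γ • reducedResolvent (H s) (E s))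
      (fun s => γ⁻¹ * E s) where
  uniqueDiffOn := uniqueDiffOn_Icc zero_lt_one
  isJetWeight := isJetWeight_jetWeight ((norm_nonneg _).trans (ha₁ 0 unitInterval.zero_mem)) hb
    ((norm_nonneg _).trans (hd₃ 0 unitInterval.zero_mem))
  hasDerivWithinAt s hs := (hH s hs).const_smul γ⁻¹
  jet_velocity := jetBound_jetWeight ((norm_nonneg _).trans (ha₁ 0 unitInterval.zero_mem)) hb
    (fun s hs => (hH₁ s hs).const_smul γ⁻¹) (fun s hs => (hH₂ s hs).const_smul γ⁻¹) ha₁ hb₂ hd₃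
  continuousOn_energy := hE.const_mul γ⁻¹
  isReducedResolvent s hs := by
    simpa only [smul_sub, smul_smul] using
      (isReducedResolvent_eigenprojection (hsa s hs) hγ (hgap s hs)).smul hγ.ne'
  proj_ne_zero s hs := eigenprojection_ne_zero (hsa s hs) (hmem s hs) hγ (hgap s hs)
  norm_resolvent_le s hs := by
    rw [norm_smul, Real.norm_of_nonneg hγ.le]
    exact (mul_le_mul_of_nonneg_left (norm_reducedResolvent_le hγ (hgap s hs)) hγ.le).trans_eq
      (mul_inv_cancel₀ hγ.ne')

theorem theorem1_general (hT : 0 < T) (hγ : 0 < γ)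
    (hsa : ∀ s ∈ Icc (0 : ℝ) 1, IsSelfAdjoint (H s))
    (hH : ∀ s ∈ Icc (0 : ℝ) 1, HasDerivWithinAt H (H₁ s) (Icc 0 1) s)
    (hH₁ : ∀ s ∈ Icc (0 : ℝ) 1, HasDerivWithinAt H₁ (H₂ s) (Icc 0 1) s)
    (hH₂ : ∀ s ∈ Icc (0 : ℝ) 1, HasDerivWithinAt H₂ (H₃ s) (Icc 0 1) s)
    (ha : ∀ s ∈ Icc (0 : ℝ) 1, ‖H₁ s‖ ≤ a) (hb : ∀ s ∈ Icc (0 : ℝ) 1, ‖H₂ s‖ ≤ b)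
    (hd : ∀ s ∈ Icc (0 : ℝ) 1, ‖H₃ s‖ ≤ d) (hE : ContinuousOn E (Icc 0 1))
    (hmem : ∀ s ∈ Icc (0 : ℝ) 1, E s ∈ spectrum ℝ (H s))
    (hgap : ∀ s ∈ Icc (0 : ℝ) 1, ∀ x ∈ spectrum ℝ (H s), x ≠ E s → γ ≤ |x - E s|)
    (hU : IsPropagator T H U) :
    ‖(1 - eigenprojection (H 1) (E 1)) * (U 1 * eigenprojection (H 0) (E 0))‖ ≤
      10 ^ 14 * (a / γ / (γ * T) + (d / γ + (b / γ) ^ 3 + (a / γ) ^ 6) / (γ * T) ^ 2) := by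
  have hscale : ∀ {x : A} {c : ℝ}, ‖x‖ ≤ c → ‖γ⁻¹ • x‖ ≤ c / γ := fun {x c} hx => by
    rw [norm_smul, Real.norm_of_nonneg (inv_nonneg.2 hγ.le), div_eq_inv_mul]
    exact mul_le_mul_of_nonneg_left hx (inv_nonneg.2 hγ.le)
  let β := min (b / γ) (4 * (a / γ) + d / γ)
  have hβ : ∀ s ∈ Icc (0 : ℝ) 1, ‖γ⁻¹ • H₂ s‖ ≤ β := fun s hs =>
    le_min (hscale (hb s hs)) (norm_deriv_le_of_norm_second_deriv_le
      (fun s hs => (hH₁ s hs).const_smul γ⁻¹) (fun s hs => (hH₂ s hs).const_smul γ⁻¹)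
      (fun s hs => hscale (ha s hs)) (fun s hs => hscale (hd s hs)) s hs)
  have hβ0 : 0 ≤ β := (norm_nonneg _).trans (hβ 0 unitInterval.zero_mem)
  have hd0 : 0 ≤ d / γ := (norm_nonneg _).trans (hscale (hd 0 unitInterval.zero_mem))
  have hfam := gappedFamily_rescale hγ hβ0 hsa hH hH₁ hH₂ (fun s hs => hscale (ha s hs)) hβ
    (fun s hs => hscale (hd s hs)) hE hmem hgap
  refine (hfam.norm_leakage_le (hU.rescale hγ.ne') (mul_pos hγ hT) hβ0 hd0
    (min_le_right _ _)).trans ?_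
  gcongr
  exact min_le_left _ _

end General

section FiniteDimensional

variable {N : ℕ}

theorem isEnergy_iff_mem_spectrum {B : QOp N} {μ : ℝ} : IsEnergy B μ ↔ μ ∈ spectrum ℝ B := by
  rw [IsEnergy, Module.End.hasEigenvalue_iff_mem_spectrum, ← spectrum.algebraMap_mem_iff ℂ,
    ← AlgEquiv.spectrum_eq (Module.End.toContinuousLinearMap (QState N))]
  rfl

theorem IsReducedResolvent.eq_stateProj {k p r : QOp N} (h : IsReducedResolvent k p r)
    {g : QState N} (hg : ‖g‖ = 1) (hkg : k g = 0) (hker : ∀ x, k x = 0 → ∃ c : ℂ, c • g = x) :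
    p = stateProj g := by
  have hpg : p g = g := by
    have hg0 : 0 = g - p g := by simpa [hkg] using congr($h.resolvent_mul g)
    exact (sub_eq_zero.1 hg0.symm).symm
  ext1 x
  obtain ⟨c, hc⟩ := hker (p x) congr($h.mul_proj x)
  have hinner : inner ℂ g (p x) = inner ℂ g x := by
    rw [← ContinuousLinearMap.adjoint_inner_left, ← ContinuousLinearMap.star_eq_adjoint,
      h.isStarProjection.isSelfAdjoint.star_eq, hpg]
  rw [stateProj, InnerProductSpace.rankOne_apply, ← hinner, ← hc, inner_smul_right,
    inner_self_eq_norm_sq_to_K, hg]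
  simp

theorem IsEvolution.isPropagator {T : ℝ} {H U : ℝ → QOp N} (hU : IsEvolution T H U) :
    IsPropagator T H U :=
  ⟨hU.init, hU.hasDeriv⟩

end FiniteDimensional

namespace ThriceDifferentiable

variable {N : ℕ} {H : ℝ → QOp N}

theorem hasDerivWithinAt (hH : ThriceDifferentiable H) {k : ℕ} (hk : k < 3) :
    ∀ s ∈ Icc (0 : ℝ) 1, HasDerivWithinAt (iteratedDerivWithin k H (Icc 0 1))
      (iteratedDerivWithin (k + 1) H (Icc 0 1) s) (Icc 0 1) s := fun s hs => by
  rw [iteratedDerivWithin_succ]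
  exact (hH.differentiableOn k hk s hs).hasDerivWithinAt

theorem norm_le_derivMax (hH : ThriceDifferentiable H) {k : ℕ} (hk : k ≤ 3) :
    ∀ s ∈ Icc (0 : ℝ) 1, ‖iteratedDerivWithin k H (Icc 0 1) s‖ ≤ derivMax k H := fun s hs => by
  refine le_csSup ?_ (mem_image_of_mem _ hs)
  rcases hk.lt_or_eq with h | rfl
  · exact isCompact_Icc.bddAbove_image (hH.differentiableOn k h).continuousOn.norm
  · exact hH.bddAbove

theorem derivMax_nonneg (hH : ThriceDifferentiable H) {k : ℕ} (hk : k ≤ 3) : 0 ≤ derivMax k H :=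
  (norm_nonneg _).trans (hH.norm_le_derivMax hk 0 unitInterval.zero_mem)

end ThriceDifferentiable

section Gap

variable {N : ℕ} {T : ℝ} {H : ℝ → QOp N} {E : ℝ → ℝ} {s μ : ℝ}

theorem gapFrom_le (hs : s ∈ Icc (0 : ℝ) 1) (hμ : IsEnergy (H s) μ) (hne : μ ≠ E s) :
    gapFrom H E ≤ |μ - E s| := by
  refine csInf_le ⟨0, ?_⟩ ⟨s, hs, μ, hμ, hne, rfl⟩
  rintro _ ⟨_, _, _, _, _, rfl⟩
  exact abs_nonneg _

theorem gapMin_le_gapFrom (hE : ∀ s ∈ Icc (0 : ℝ) 1, IsEnergy (H s) (E s)) (h : 0 < gapMin H) :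
    gapMin H ≤ gapFrom H E := by
  have hne : {d : ℝ | ∃ s ∈ Icc (0 : ℝ) 1, ∃ μ ν : ℝ,
      IsEnergy (H s) μ ∧ IsEnergy (H s) ν ∧ μ ≠ ν ∧ d = |μ - ν|}.Nonempty :=
    nonempty_iff_ne_empty.2 fun hempty => h.ne' (by rw [gapMin, hempty, Real.sInf_empty])
  refine le_csInf ?_ ?_
  · obtain ⟨_, s, hs, μ, ν, hμ, hν, hμν, -⟩ := hne
    by_cases hμE : μ = E s
    · exact ⟨_, s, hs, ν, hν, fun hνE => hμν (hμE.trans hνE.symm), rfl⟩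
    · exact ⟨_, s, hs, μ, hμ, hμE, rfl⟩
  · rintro _ ⟨s, hs, μ, hμ, hne, rfl⟩
    refine csInf_le ⟨0, ?_⟩ ⟨s, hs, μ, E s, hμ, hE s hs, hne, rfl⟩
    rintro _ ⟨_, _, _, _, _, _, _, rfl⟩
    exact abs_nonneg _

theorem le_timescale₀_div (hT : 0 < T) (hH : ThriceDifferentiable H) (hm : 0 < gapMin H)
    (hle : gapMin H ≤ gapFrom H E) :
    derivMax 1 H / gapFrom H E / (gapFrom H E * T) +
        (derivMax 3 H / gapFrom H E + (derivMax 2 H / gapFrom H E) ^ 3 +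
          (derivMax 1 H / gapFrom H E) ^ 6) / (gapFrom H E * T) ^ 2 ≤
      timescale₀ T H E / T := by
  have ha : 0 ≤ derivMax 1 H := hH.derivMax_nonneg (by norm_num)
  have hb : 0 ≤ derivMax 2 H := hH.derivMax_nonneg (by norm_num)
  have hd : 0 ≤ derivMax 3 H := hH.derivMax_nonneg le_rfl
  rw [timescale₀, timescale₁]
  generalize derivMax 1 H = a, derivMax 2 H = b, derivMax 3 H = d, gapMin H = m,
    gapFrom H E = g at *
  have hscale : (a / g ^ 2 + 1 / m * (d / m + b ^ 3 / m ^ 3 + a ^ 6 / m ^ 6) / (m * T)) / T =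
      a / g / (g * T) + (d / m + (b / m) ^ 3 + (a / m) ^ 6) / (m * T) ^ 2 := by
    simp only [div_pow]
    ring
  have hg : 0 < g := hm.trans_le hle
  rw [hscale]
  gcongr

end Gap

namespace IsNondegenerateEigenstate

variable {N : ℕ} {T : ℝ} {H U : ℝ → QOp N} {E : ℝ → ℝ} {G : ℝ → QState N} {s γ : ℝ}

theorem hasEigenvector (hG : IsNondegenerateEigenstate H E G) (hs : s ∈ Icc (0 : ℝ) 1) :
    Module.End.HasEigenvector (H s : QState N →ₗ[ℂ] QState N) (E s : ℂ) (G s) :=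
  ⟨Module.End.mem_eigenspace_iff.2 (hG.apply_eq s hs),
    norm_ne_zero_iff.1 ((hG.norm_eq_one s hs).trans_ne one_ne_zero)⟩

theorem isEnergy (hG : IsNondegenerateEigenstate H E G) (hs : s ∈ Icc (0 : ℝ) 1) :
    IsEnergy (H s) (E s) :=
  Module.End.hasEigenvalue_of_hasEigenvector (hG.hasEigenvector hs)

theorem eigenprojection_eq (hG : IsNondegenerateEigenstate H E G) (hs : s ∈ Icc (0 : ℝ) 1)
    (hsa : IsSelfAdjoint (H s)) (hγ : 0 < γ)
    (hgap : ∀ x ∈ spectrum ℝ (H s), x ≠ E s → γ ≤ |x - E s|) :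
    eigenprojection (H s) (E s) = stateProj (G s) := by
  have hker : ∀ x, (H s - E s • (1 : QOp N)) x = 0 ↔ H s x = (E s : ℂ) • x := fun x => by
    rw [← sub_eq_zero (a := H s x), Complex.coe_smul]
    rfl
  refine (isReducedResolvent_eigenprojection hsa hγ hgap).eq_stateProj (hG.norm_eq_one s hs)
    ((hker _).2 (hG.apply_eq s hs)) fun x hx => ?_
  obtain ⟨hmem, hne⟩ := hG.hasEigenvector hs
  obtain ⟨c, hc⟩ := (finrank_eq_one_iff_of_nonzero' ⟨G s, hmem⟩ (by simpa using hne)).1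
    (hG.nondegenerate s hs) ⟨x, Module.End.mem_eigenspace_iff.2 ((hker x).1 hx)⟩
  exact ⟨c, congrArg Subtype.val hc⟩

theorem norm_adiabaticError_le (hG : IsNondegenerateEigenstate H E G) :
    ‖adiabaticError U G‖ ≤ ‖(1 - stateProj (G 1)) * (U 1 * stateProj (G 0))‖ := by
  have hG0 : ‖G 0‖ = 1 := hG.norm_eq_one 0 unitInterval.zero_mem
  have herr : adiabaticError U G = ((1 - stateProj (G 1)) * (U 1 * stateProj (G 0))) (G 0) := by
    simp [adiabaticError, stateProj, inner_self_eq_norm_sq_to_K, hG0]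
  rw [herr]
  exact ContinuousLinearMap.unit_le_opNorm _ _ hG0.le

theorem norm_adiabaticError_le_timescale₀_div (hG : IsNondegenerateEigenstate H E G) (hT : 0 < T)
    (hsa : ∀ s ∈ Icc (0 : ℝ) 1, IsSelfAdjoint (H s)) (hH : ThriceDifferentiable H)
    (hm : 0 < gapMin H) (hU : IsEvolution T H U) :
    ‖adiabaticError U G‖ ≤ 10 ^ 14 * (timescale₀ T H E / T) := by
  have hle : gapMin H ≤ gapFrom H E := gapMin_le_gapFrom (fun s hs => hG.isEnergy hs) hm
  have hγ : 0 < gapFrom H E := hm.trans_le hle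
  have hgap : ∀ s ∈ Icc (0 : ℝ) 1, ∀ x ∈ spectrum ℝ (H s), x ≠ E s → gapFrom H E ≤ |x - E s| :=
    fun s hs x hx => gapFrom_le hs (isEnergy_iff_mem_spectrum.2 hx)
  have hproj : ∀ s ∈ Icc (0 : ℝ) 1, eigenprojection (H s) (E s) = stateProj (G s) :=
    fun s hs => hG.eigenprojection_eq hs (hsa s hs) hγ (hgap s hs)
  have hgeneral := theorem1_general hT hγ hsa
    (by simpa only [iteratedDerivWithin_zero] using hH.hasDerivWithinAt zero_lt_three)
    (hH.hasDerivWithinAt (by norm_num)) (hH.hasDerivWithinAt (by norm_num))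
    (hH.norm_le_derivMax (by norm_num)) (hH.norm_le_derivMax (by norm_num))
    (hH.norm_le_derivMax le_rfl) hG.continuousOn
    (fun s hs => isEnergy_iff_mem_spectrum.1 (hG.isEnergy hs)) hgap hU.isPropagator
  rw [hproj 0 unitInterval.zero_mem, hproj 1 unitInterval.one_mem] at hgeneral
  exact hG.norm_adiabaticError_le.trans (hgeneral.trans
    (mul_le_mul_of_nonneg_left (le_timescale₀_div hT hH hm hle) (by norm_num)))

end IsNondegenerateEigenstate

theorem theorem1 :
    ∃ C : ℝ, 0 < C ∧
      ∀ (N : ℕ) (H : ℝ → ℝ → QOp N) (E : ℝ → ℝ → ℝ) (G : ℝ → ℝ → QState N)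
        (U : ℝ → ℝ → QOp N),
        (∀ T : ℝ, 0 < T → ∀ s ∈ Icc (0 : ℝ) 1, IsSelfAdjoint (H T s)) →
        (∀ T : ℝ, 0 < T → ThriceDifferentiable (H T)) →
        (∀ T : ℝ, 0 < T → 0 < gapMin (H T)) →
        (∀ T : ℝ, 0 < T → IsNondegenerateEigenstate (H T) (E T) (G T)) →
        (∀ T : ℝ, 0 < T → IsEvolution T (H T) (U T)) →
        (fun T : ℝ => timescale₀ T (H T) (E T)) =o[atTop] (fun T : ℝ => T) →
        IsBigOWith C atTop (fun T : ℝ => adiabaticError (U T) (G T))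
          (fun T : ℝ => timescale₀ T (H T) (E T) / T) := by
  exact ⟨10 ^ 14, by norm_num, fun N H E G U hsa hH hm hG hU _ =>
    .of_bound ((eventually_gt_atTop 0).mono fun T hT =>
      ((hG T hT).norm_adiabaticError_le_timescale₀_div hT (hsa T hT) (hH T hT) (hm T hT)
        (hU T hT)).trans (mul_le_mul_of_nonneg_left (Real.le_norm_self _) (by norm_num)))⟩
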